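/- **Conventions.** For $k\ge 1$ let $P_k=\mathbb F_2[x_1,\dots,x_k]$, with $\deg x_i=1$, be the polynomial algebra with its standard action of the Steenrod squares $Sq^i$ of the mod-2 Steenrod algebra $\mathcal A$ ($Sq^0=\mathrm{id}$, $Sq^1x_j=x_j^2$, $Sq^ix_j=0$ for $i>1$, and the Cartan formula). Let $\mathcal A^+P_k$ be the subspace of all finite sums $\sum_{i>0}Sq^i(h_i)$ (the *hit* polynomials), $QP_k=P_k/\mathcal A^+P_k$, $[f]$ the class of $f$ in $QP_k$, and $(QP_k)_n$ the subspace of classes of homogeneous polynomials of degree $n$. For $s\ge 1$ let $\mathcal A(s-1)$ be the subalgebra of $\mathcal A$ generated by the $Sq^i$ with $0\le i<2^s$, and let $\mathcal A(s-1)^+=\mathcal A(s-1)\cap\mathcal A^+$. *Kameko's operation.* The linear map $\varphi:P_k\to P_k$ with $\varphi(x_1x_2\cdots x_k\,y^2)=y$ for every monomial $y$, and $\varphi(x)=0$ for every other monomial $x$, maps hit polynomials to hit polynomials and so induces a map $QP_k\to QP_k$. For $n-k$ even and nonnegative it restricts to $(\widetilde{Sq}^0_*)_{(k,n)}:(QP_k)_n\to(QP_k)_{\frac{n-k}2}$.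 *Monomials.* For a monomial $x=x_1^{a_1}\cdots x_k^{a_k}$ let $\omega_i(x)$, $i\ge1$, be the number of $j$ for which the coefficient of $2^{i-1}$ in the binary expansion of $a_j$ is $1$. Let $\omega(x)=(\omega_1(x),\omega_2(x),\dots)$ and $\sigma(x)=(a_1,\dots,a_k)$. Weight vectors $\omega(x)$ and exponent vectors $\sigma(x)$ are ordered left lexicographically. For monomials of the same degree, $x<y$ means that $\omega(x)<\omega(y)$, or $\omega(x)=\omega(y)$ and $\sigma(x)<\sigma(y)$. A monomial $x$ is *inadmissible* if $x+\sum_ty_t$ is hit for some finite, possibly empty, family of monomials $y_t<x$ of the same degree; otherwise it is *admissible*. Let $B_k(n)$ be the set of admissible monomials of degree $n$ in $P_k$. Let $P_k^-(\omega(x))$ be the span of the monomials $y$ with $\deg y=\deg x$ and $\omega(y)<\omega(x)$. The *minimal spike* of degree $n$ in $P_k$, if it exists, is the monomial $z=\prod_jx_j^{2^{s_j}-1}$ of degree $n$ with $s_1>s_2>\dots>s_{r-1}\ge s_r>0$ and $s_j=0$ for $j>r$. Let $\mathcal P_{(k,n)}$ be the span of the monomials $x$ of degree $n$ such that $\sum_{j\le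 h}2^{j-1}\omega_j(x)<\sum_{j\le h}2^{j-1}\omega_j(z)$ for some $h\ge1$. *Pairs of sequences.* Let $\mathsf{PSeq}_k^d$ be the set of pairs $(\mathcal I,\mathcal J)$ of sequences $\mathcal I=(i_1,\dots,i_d)$, $\mathcal J=(j_1,\dots,j_d)$ of integers with $1\le i_t<j_t\le k$ for all $t$, and let $\mathsf{PInc}_k^d$ be the subset of those pairs in which both sequences are nondecreasing. Put $$X_{i,j}=\prod_{l\ne i,j}x_l,\qquad X_{(\mathcal I,\mathcal J)}=\prod_{t=1}^dX_{i_t,j_t}^{2^{d-t}}.$$ The reduced length $\mathrm{rl}(S)$ of a finite sequence $S$ is its length minus the length of its first maximal run of equal terms. For $d_0>2$, a set $\mathcal B\subset\mathsf{PInc}_k^{d_0}$ is *compatible with $(k-2)|^{d_0}$* if (i) $\mathrm{rl}(\mathcal I)\le d_0-2$ and $\mathrm{rl}(\mathcal J)\le d_0-2$ for all $(\mathcal I,\mathcal J)\in\mathcal B$; and (ii) for every $(\mathcal H,\mathcal K)\in\mathsf{PSeq}_k^{d_0}$ there are sets $\mathcal B_u\subset\{(\mathcal I,\mathcal J)\in\mathcal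 B:\min\mathcal I=\min\mathcal H,\ \min\mathcal J=u\}$ such that $$X_{(\mathcal H,\mathcal K)}+\sum_{u=\min\mathcal H+1}^{\min\mathcal K}\ \sum_{(\mathcal I,\mathcal J)\in\mathcal B_u}X_{(\mathcal I,\mathcal J)}\ \in\ \mathcal A(d_0-1)^+P_k+P_k^-(\omega(X_{(\mathcal H,\mathcal K)}))+\mathcal P_{(k,(k-2)(2^{d_0}-1))}.$$ For $1\le i\le k$ let $f_i:P_{k-1}\to P_k$ be the algebra homomorphism with $f_i(x_u)=x_u$ for $u<i$ and $f_i(x_u)=x_{u+1}$ for $u\ge i$. For $1\le i<j\le k$ put $f_{(i,j)}=f_i\circ f_{j-1}:P_{k-2}\to P_k$. **Theorem.** Let $d_0>2$, $k\ge4$ and $n=\sum_{i=1}^{k-2}(2^{d_i}-1)$, where $d_1>d_2>\dots>d_{k-3}\ge d_{k-2}=d\ge d_0$ are integers. Let $m=\sum_{i=1}^{k-3}(2^{d_i-d}-1)$. Suppose that $\mathcal B\subset\mathsf{PInc}_k^{d_0}$ is compatible with $(k-2)|^{d_0}$. Then: 1. $m=\beta_k^d(n)$, the $d$-fold iterate at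 $n$ of the function $\beta_k:\mathbb Z\to\mathbb Z$ given by $\beta_k(t)=\frac{t-k+2}2$ if $t-k+2$ is even and $\beta_k(t)=0$ otherwise. 2. The classes in $QP_k$ of the elements of $$\overline{\mathcal B}=\bigcup_{(\mathcal I,\mathcal J)\in\mathcal B}\Big\{X_{(\mathcal I,\mathcal J)}\,X_{i,j}^{2^d-2^{d_0}}\,\big(f_{(i,j)}(y)\big)^{2^d}\ :\ y\in B_{k-2}(m)\Big\},\qquad i=\min\mathcal I,\ j=\min\mathcal J,$$ span exactly the $\mathbb F_2$-vector space $\mathrm{Ker}(\widetilde{Sq}^0_*)_{(k,n)}$. 3. Consequently, $\dim\mathrm{Ker}(\widetilde{Sq}^0_*)_{(k,n)}\le|\mathcal B|\cdot\dim(QP_{k-2})_m$. -/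

import Mathlib

namespace HitProblem

/-! Variables are indexed by `Fin k`, so the variable written `x_l` (with `1 ≤ l ≤ k`) is
`MvPolynomial.X (l - 1)`; all variable indices below start at `0`. In the same way, the `i`-th
entry `ω_i` (`i ≥ 1`) of a weight vector is its value at `i - 1`. -/

/-- The polynomial algebra `P_k = 𝔽₂[x_1, …, x_k]`. -/
abbrev P (k : ℕ) : Type := MvPolynomial (Fin k) (ZMod 2)

/-- The monomial with exponent vector `a`. -/
noncomputable def mon {k : ℕ} (a : Fin k →₀ ℕ) : P k := MvPolynomial.monomial a 1

/-! ### The Steenrod squares and hit polynomials -/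

/-- The total Steenrod square `∑ₙ Sqⁿ Tⁿ`, the homomorphism of algebras `P_k → P_k[T]` that sends
each variable `x` to `x + x² T`. Its multiplicativity is the Cartan formula. -/
noncomputable def totalSq (k : ℕ) : P k →ₐ[ZMod 2] Polynomial (P k) :=
  MvPolynomial.aeval fun i =>
    Polynomial.C (MvPolynomial.X i) + Polynomial.C (MvPolynomial.X i ^ 2) * Polynomial.X

/-- The Steenrod square `Sqⁿ` on `P_k`. -/
noncomputable def Sq (k n : ℕ) : P k →ₗ[ZMod 2] P k :=
  ((Polynomial.lcoeff (P k) n).restrictScalars (ZMod 2)).comp (totalSq k).toLinearMap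

/-- `𝒜⁺P_k`: the hit polynomials, that is the finite sums `∑_{n > 0} Sqⁿ(hₙ)`. -/
noncomputable def hit (k : ℕ) : Submodule (ZMod 2) (P k) :=
  ⨆ n : {n : ℕ // 0 < n}, LinearMap.range (Sq k n)

/-- `𝒜(s-1)⁺P_k`, where `𝒜(s-1)` is the subalgebra of the Steenrod algebra generated by the `Sqⁱ`
with `0 ≤ i < 2^s`. Its augmentation ideal `𝒜(s-1)⁺` is the algebra without unit generated by the
`Sqⁱ` with `0 < i < 2^s`. -/
noncomputable def subHit (k s : ℕ) : Submodule (ZMod 2) (P k) :=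
  Submodule.span (ZMod 2)
    {g | ∃ θ ∈ NonUnitalAlgebra.adjoin (ZMod 2)
        {T : Module.End (ZMod 2) (P k) | ∃ i, 0 < i ∧ i < 2 ^ s ∧ T = Sq k i},
      ∃ f : P k, g = θ f}

/-- `QP_k = P_k / 𝒜⁺P_k`. -/
abbrev QP (k : ℕ) : Type := P k ⧸ hit k

/-- `(QP_k)_n`: the classes represented by the homogeneous polynomials of degree `n`. -/
noncomputable def QPdeg (k n : ℕ) : Submodule (ZMod 2) (QP k) :=
  (MvPolynomial.homogeneousSubmodule (Fin k) (ZMod 2) n).map (hit k).mkQ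

/-! ### Kameko's squaring operation -/

open Classical in
/-- The linear map `φ` with `φ(x_1 x_2 ⋯ x_k y²) = y` for each monomial `y`, and `φ(x) = 0` for
each monomial `x` that is not of this form. -/
noncomputable def phi (k : ℕ) : P k →ₗ[ZMod 2] P k :=
  (MvPolynomial.basisMonomials (Fin k) (ZMod 2)).constr (ZMod 2) fun a =>
    if ∀ i, Odd (a i) then mon (a.mapRange (fun e => e / 2) rfl) else 0

open Classical in
theorem phi_mon {k : ℕ} (a : Fin k →₀ ℕ) :
    phi k (mon a) = if ∀ i, Odd (a i) then mon (a.mapRange (fun e => e / 2) rfl) else 0 := by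
  have h : (mon a : P k) = MvPolynomial.basisMonomials (Fin k) (ZMod 2) a := by
    simp [mon]
  rw [h, phi, Module.Basis.constr_basis]

theorem mon_mul {k : ℕ} (a b : Fin k →₀ ℕ) : (mon a * mon b : P k) = mon (a + b) := by
  simp [mon, MvPolynomial.monomial_mul]

/-- Linear maps on `P_k` that agree on monomials are equal. -/
theorem lin_ext {k : ℕ} {M : Type*} [AddCommMonoid M] [Module (ZMod 2) M]
    {f g : P k →ₗ[ZMod 2] M} (h : ∀ a, f (mon a) = g (mon a)) : f = g := by
  apply (MvPolynomial.basisMonomials (Fin k) (ZMod 2)).ext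
  intro a
  simpa [mon] using h a

/-- Squaring is linear over `𝔽₂`. -/
theorem sq_add {R : Type*} [CommRing R] [Algebra (ZMod 2) R] (p q : R) :
    (p + q) ^ 2 = p ^ 2 + q ^ 2 := by
  have h2 : (2 : R) = 0 := by
    have := map_ofNat (algebraMap (ZMod 2) R) 2
    rw [← this, show (OfNat.ofNat 2 : ZMod 2) = 0 from rfl, map_zero]
  linear_combination p * q * h2

theorem phi_mul_sq {k : ℕ} (f g : P k) : phi k (f * g ^ 2) = phi k f * g := by
  induction g using MvPolynomial.induction_on with
  | C r =>
    have h : ∀ r : ZMod 2, r ^ 2 = r := by decide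
    rw [← map_pow, h, mul_comm, mul_comm _ (MvPolynomial.C r), ← MvPolynomial.smul_eq_C_mul,
      ← MvPolynomial.smul_eq_C_mul, map_smul]
  | add p q hp hq =>
    rw [sq_add, mul_add, mul_add, map_add, hp, hq]
  | mul_X p i hp =>
    have key : ∀ f : P k, phi k (f * MvPolynomial.X i ^ 2) = phi k f * MvPolynomial.X i := by
      intro f
      have hX : (MvPolynomial.X i : P k) = mon (Finsupp.single i 1) := rfl
      have hX2 : (MvPolynomial.X i ^ 2 : P k) = mon (Finsupp.single i 2) := by
        rw [hX, pow_two, mon_mul, ← Finsupp.single_add]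
      have := @lin_ext k (P k) _ _ ((phi k).comp (LinearMap.mulRight (ZMod 2) (MvPolynomial.X i ^ 2)))
        ((LinearMap.mulRight (ZMod 2) (MvPolynomial.X i)).comp (phi k)) (by
          intro a
          simp only [LinearMap.comp_apply, LinearMap.mulRight_apply]
          rw [hX2, hX, mon_mul, phi_mon, phi_mon]
          have hodd : (∀ j, Odd ((a + Finsupp.single i 2 : Fin k →₀ ℕ) j)) ↔ ∀ j, Odd (a j) := by
            refine forall_congr' fun j => ?_
            rw [Finsupp.add_apply, Finsupp.single_apply]
            split_ifs <;> simp [parity_simps]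
          by_cases h : ∀ j, Odd (a j)
          · rw [if_pos h, if_pos (hodd.2 h), mon_mul]
            congr 1
            ext j
            simp only [Finsupp.mapRange_apply, Finsupp.add_apply, Finsupp.single_apply]
            split_ifs <;> omega
          · rw [if_neg h, if_neg (fun h' => h (hodd.1 h')), zero_mul])
      exact LinearMap.congr_fun this f
    rw [mul_pow, ← mul_assoc, key, hp, mul_assoc]

theorem Sq_apply {k n : ℕ} (f : P k) : Sq k n f = (totalSq k f).coeff n := rfl

/-- The Cartan formula. -/
theorem Sq_mul {k n : ℕ} (f g : P k) :
    Sq k n (f * g) = ∑ p ∈ Finset.HasAntidiagonal.antidiagonal n, Sq k p.1 f * Sq k p.2 g := by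
  simp only [Sq_apply, map_mul, Polynomial.coeff_mul]

theorem Sq_sq {k n : ℕ} (g : P k) :
    Sq k n (g ^ 2) = if 2 ∣ n then (Sq k (n / 2) g) ^ 2 else 0 := by
  simp only [Sq_apply, map_pow]
  rw [← Polynomial.map_frobenius_expand 2, Polynomial.coeff_map,
    Polynomial.coeff_expand (by norm_num)]
  split_ifs <;> simp [frobenius_def]

theorem prod_X_eq_mon {k : ℕ} (t : Finset (Fin k)) :
    (∏ i ∈ t, MvPolynomial.X i : P k) =
      mon (Finsupp.equivFunOnFinite.symm fun i => if i ∈ t then 1 else 0) := by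
  rw [mon, MvPolynomial.monomial_eq, map_one, one_mul, Finsupp.prod_fintype _ _ (by simp)]
  simp [pow_ite]

theorem phi_prod {k : ℕ} (t : Finset (Fin k)) :
    phi k (∏ i ∈ t, MvPolynomial.X i) = if t = Finset.univ then 1 else 0 := by
  rw [prod_X_eq_mon, phi_mon]
  by_cases h : t = Finset.univ
  · subst h
    rw [if_pos (by simp), if_pos rfl]
    have : (Finsupp.mapRange (fun e => e / 2) rfl (Finsupp.equivFunOnFinite.symm
        fun i : Fin k => if i ∈ Finset.univ then 1 else 0) : Fin k →₀ ℕ) = 0 := by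
      ext i; simp
    rw [this, mon]; rfl
  · rw [if_neg h, if_neg]
    intro h'
    apply h
    ext i
    have h2 := h' i
    by_contra hi
    have hit : i ∉ t := fun h3 => hi (by simp [h3])
    simp [hit] at h2

theorem phi_Sq_prod {k n : ℕ} (s : Finset (Fin k)) :
    phi k (Sq k n (∏ i ∈ s, MvPolynomial.X i)) =
      if n = 0 then phi k (∏ i ∈ s, MvPolynomial.X i) else 0 := by
  have h1 : Sq k n (∏ i ∈ s, MvPolynomial.X i) = ∑ t ∈ s.powerset,
      if n = (s \ t).card then
        (∏ i ∈ t, MvPolynomial.X i) * (∏ i ∈ s \ t, MvPolynomial.X i) ^ 2 else 0 := by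
    rw [Sq_apply, map_prod]
    simp only [totalSq, MvPolynomial.aeval_X]
    rw [Finset.prod_add, Polynomial.finsetSum_coeff]
    refine Finset.sum_congr rfl fun t _ => ?_
    rw [Finset.prod_mul_distrib, Finset.prod_const, ← map_prod, ← map_prod, ← mul_assoc,
      ← map_mul, Polynomial.coeff_C_mul_X_pow, Finset.prod_pow]
  rw [h1, map_sum]
  rcases Nat.eq_zero_or_pos n with rfl | hn
  · rw [if_pos rfl, Finset.sum_eq_single_of_mem s (by simp)]
    · simp
    · intro t ht hts
      rw [if_neg, map_zero]
      intro h
      rw [eq_comm, Finset.card_eq_zero, Finset.sdiff_eq_empty_iff_subset] at h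
      exact hts (le_antisymm (Finset.mem_powerset.1 ht) h)
  · rw [if_neg hn.ne']
    refine Finset.sum_eq_zero fun t ht => ?_
    split_ifs with h
    · rw [phi_mul_sq, phi_prod, if_neg, zero_mul]
      intro ht'
      rw [ht'] at h
      rw [Finset.sdiff_eq_empty_iff_subset.2 (Finset.subset_univ s), Finset.card_empty] at h
      omega
    · simp

theorem exists_mon_eq {k : ℕ} (a : Fin k →₀ ℕ) :
    ∃ (s : Finset (Fin k)) (b : Fin k →₀ ℕ),
      (mon a : P k) = (∏ i ∈ s, MvPolynomial.X i) * mon b ^ 2 := by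
  refine ⟨Finset.univ.filter fun i => a i % 2 = 1, a.mapRange (fun e => e / 2) rfl, ?_⟩
  rw [prod_X_eq_mon, pow_two, mon_mul, mon_mul]
  congr 1
  ext i
  simp
  split_ifs <;> omega

/-- `φ` maps hit polynomials to hit polynomials. -/
theorem hit_le_comap_phi (k : ℕ) : hit k ≤ (hit k).comap (phi k) := by
  refine iSup_le ?_
  rintro ⟨n, hn⟩
  rintro _ ⟨f, rfl⟩
  have hle : LinearMap.range ((hit k).mkQ.comp ((phi k).comp (Sq k n))) ≤ ⊥ := by
    rw [le_bot_iff, LinearMap.range_eq_bot]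
    apply lin_ext
    intro a
    rw [LinearMap.zero_apply, LinearMap.comp_apply, Submodule.mkQ_apply,
      Submodule.Quotient.mk_eq_zero, LinearMap.comp_apply]
    obtain ⟨s, b, hab⟩ := exists_mon_eq a
    rw [hab, Sq_mul, map_sum]
    refine Submodule.sum_mem _ ?_
    rintro ⟨p, q⟩ hpq
    rw [Finset.HasAntidiagonal.mem_antidiagonal] at hpq
    rw [Sq_sq]
    split_ifs with h
    · rw [phi_mul_sq, phi_Sq_prod]
      split_ifs with hp
      · rw [phi_prod]
        split_ifs
        · rw [one_mul]
          have hq : 0 < q / 2 := by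
            simp only at hp h hpq
            omega
          exact Submodule.mem_iSup_of_mem (⟨q / 2, hq⟩ : {n : ℕ // 0 < n}) ⟨mon b, rfl⟩
        · simp
      · simp
    · simp
  have := hle ⟨f, rfl⟩
  simpa using this

/-- Kameko's squaring operation `QP_k → QP_k`, induced by `φ`. -/
noncomputable def kameko (k : ℕ) : QP k →ₗ[ZMod 2] QP k :=
  Submodule.mapQ (hit k) (hit k) (phi k) (hit_le_comap_phi k)

/-- The kernel of Kameko's squaring operation on `(QP_k)_n`, as a subspace of `QP_k`. -/
noncomputable def kamekoKer (k n : ℕ) : Submodule (ZMod 2) (QP k) :=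
  QPdeg k n ⊓ LinearMap.ker (kameko k)

/-! ### Weight vectors and admissible monomials -/

/-- The weight vector of the monomial with exponent vector `a`: its value at `i`, the entry
`ω_{i+1}`, is the number of exponents whose `i`-th binary digit is `1`. -/
noncomputable def weight {k : ℕ} (a : Fin k →₀ ℕ) : ℕ →₀ ℕ :=
  Finsupp.onFinset (Finset.range (∑ j, a j))
    (fun i => (Finset.univ.filter fun j => (a j).testBit i = true).card) (by
      intro i hi
      obtain ⟨j, hj⟩ := Finset.card_ne_zero.1 hi
      have h1 : 2 ^ i ≤ a j := Nat.ge_two_pow_of_testBit (Finset.mem_filter.1 hj).2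
      have h2 : a j ≤ ∑ j, a j := Finset.single_le_sum (fun _ _ => Nat.zero_le _) (Finset.mem_univ j)
      exact Finset.mem_range.2 (Nat.lt_two_pow_self.trans_le (h1.trans h2)))

/-- The degree `∑_{i ≥ 1} 2^{i-1} ω_i` of a weight vector. -/
def weightDeg (w : ℕ →₀ ℕ) : ℕ := w.sum fun i c => 2 ^ i * c

/-- The left lexicographical order, for weight vectors and for exponent vectors. -/
def LexLT {ι : Type*} [LT ι] (u v : ι →₀ ℕ) : Prop := Pi.Lex (· < ·) (· < ·) u v

/-- The order on monomials: by weight vector, then by exponent vector. -/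
def MonLT {k : ℕ} (a b : Fin k →₀ ℕ) : Prop :=
  LexLT (weight a) (weight b) ∨ (weight a = weight b ∧ LexLT a b)

/-- A monomial is inadmissible if modulo hit polynomials it is a sum of smaller monomials of the
same degree (over `𝔽₂`, a sum over a finite set; the empty sum is allowed). -/
def Inadmissible {k : ℕ} (a : Fin k →₀ ℕ) : Prop :=
  ∃ S : Finset (Fin k →₀ ℕ), (∀ b ∈ S, b.degree = a.degree ∧ MonLT b a) ∧
    mon a + ∑ b ∈ S, mon b ∈ hit k

/-- `B_k(n)`: the admissible monomials of degree `n` (as exponent vectors). -/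
def admissibleMonomials (k n : ℕ) : Set (Fin k →₀ ℕ) :=
  {a | a.degree = n ∧ ¬ Inadmissible a}

/-- `P_k⁻(ω)`: spanned by the monomials `y` with `deg y = deg ω` and `ω(y) < ω`. -/
noncomputable def PMinus (k : ℕ) (w : ℕ →₀ ℕ) : Submodule (ZMod 2) (P k) :=
  Submodule.span (ZMod 2) (mon '' {a | a.degree = weightDeg w ∧ LexLT (weight a) w})

/-- The monomial with exponent vector `z` is a minimal spike: the exponent of the `j`-th variable
is `2^{s_j} - 1`, where `s_1 > s_2 > ⋯ > s_{r-1} ≥ s_r > 0` and `s_j = 0` for `j > r`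
(below, `s_j` is written `s (j - 1)`). -/
def IsMinimalSpike {k : ℕ} (z : Fin k →₀ ℕ) : Prop :=
  ∃ (s : ℕ → ℕ) (r : ℕ), r ≤ k ∧ (∀ j : Fin k, z j = 2 ^ s j - 1) ∧
    (∀ j, j + 2 < r → s (j + 1) < s j) ∧ (∀ j, j + 2 = r → s (j + 1) ≤ s j) ∧
    (∀ j, j < r → 0 < s j) ∧ (∀ j, r ≤ j → s j = 0)

/-- `𝒫_{(k,n)}`: spanned by the monomials `x` of degree `n` such that, for some `h ≥ 1`,
`∑_{j ≤ h} 2^{j-1} ω_j(x) < ∑_{j ≤ h} 2^{j-1} ω_j(z)`, with `z` the minimal spike of degree `n`. -/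
noncomputable def spikeSpace (k n : ℕ) : Submodule (ZMod 2) (P k) :=
  Submodule.span (ZMod 2) (mon '' {a | a.degree = n ∧ ∃ z : Fin k →₀ ℕ,
    IsMinimalSpike z ∧ z.degree = n ∧ ∃ h, 1 ≤ h ∧
      ∑ j ∈ Finset.range h, 2 ^ j * weight a j < ∑ j ∈ Finset.range h, 2 ^ j * weight z j})

/-! ### Pairs of sequences -/

/-- Pairs `(ℐ, 𝒥)` of sequences of length `d` of indices of variables of `P_k`. -/
abbrev SeqPair (k d : ℕ) : Type := (Fin d → Fin k) × (Fin d → Fin k)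

/-- `PSeq_k^d`. -/
def PSeq (k d : ℕ) : Set (SeqPair k d) := {p | ∀ t, p.1 t < p.2 t}

/-- `PInc_k^d`. -/
def PInc (k d : ℕ) : Set (SeqPair k d) := {p | p ∈ PSeq k d ∧ Monotone p.1 ∧ Monotone p.2}

/-- The least term of a sequence. -/
noncomputable def seqMin {k d : ℕ} (I : Fin d → Fin k) : ℕ := sInf (Set.range fun t => (I t : ℕ))

/-- The reduced length: the number of terms after the first maximal run of equal terms. -/
def rl {k d : ℕ} (I : Fin d → Fin k) : ℕ :=
  match List.ofFn I with
  | [] => 0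
  | c :: l => (l.dropWhile fun e => e == c).length

/-- The exponent vector of `X_{i,j}`, the product of all the variables except those with indices
`i` and `j`. -/
noncomputable def exceptExp (k i j : ℕ) : Fin k →₀ ℕ :=
  Finsupp.equivFunOnFinite.symm fun l => if (l : ℕ) = i ∨ (l : ℕ) = j then 0 else 1

/-- The exponent vector of `X_{(ℐ,𝒥)} = ∏_{1 ≤ t ≤ d} X_{i_t,j_t}^{2^{d-t}}`. -/
noncomputable def seqExp {k d : ℕ} (p : SeqPair k d) : Fin k →₀ ℕ :=
  ∑ t : Fin d, 2 ^ (d - 1 - (t : ℕ)) • exceptExp k (p.1 t) (p.2 t)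

/-- `ℬ` is compatible with `(k-2)|^d`. The congruence in the second condition is modulo
`𝒜(d-1)⁺P_k + P_k⁻(ω) + 𝒫_{(k,n_d)}`, with `ω` the weight vector of `X_{(ℋ,𝒦)}` and
`n_d = (k-2)(2^d-1)`. -/
def Compatible (k d : ℕ) (B : Set (SeqPair k d)) : Prop :=
  (∀ p ∈ B, rl p.1 ≤ d - 2 ∧ rl p.2 ≤ d - 2) ∧
  ∀ q ∈ PSeq k d, ∃ Bu : ℕ → Finset (SeqPair k d),
    (∀ u, ∀ p ∈ Bu u, p ∈ B ∧ seqMin p.1 = seqMin q.1 ∧ seqMin p.2 = u) ∧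
    mon (seqExp q) +
        ∑ u ∈ Finset.Icc (seqMin q.1 + 1) (seqMin q.2), ∑ p ∈ Bu u, mon (seqExp p) ∈
      subHit k d ⊔ PMinus k (weight (seqExp q)) ⊔ spikeSpace k ((k - 2) * (2 ^ d - 1))

/-! ### The generating set -/

/-- The homomorphism `P_{k-1} → P_k` that renames the variables in increasing order, omitting the
variable of `P_k` with index `i`. -/
noncomputable def skip (k i : ℕ) : P (k - 1) →ₐ[ZMod 2] P k :=
  MvPolynomial.rename fun u : Fin (k - 1) =>
    if (u : ℕ) < i then (⟨u, by omega⟩ : Fin k) else ⟨u + 1, by omega⟩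

/-- `f_{(i,j)} = f_i f_{j-1} : P_{k-2} → P_{k-1} → P_k`. -/
noncomputable def skip₂ (k i j : ℕ) : P (k - 2) →ₐ[ZMod 2] P k :=
  (skip k i).comp (skip (k - 1) (j - 1))

/-- The set of the monomials `X_{(ℐ,𝒥)} X_{i,j}^{2^d-2^{d₀}} f_{(i,j)}(y)^{2^d}`, where `(ℐ,𝒥) ∈ ℬ`,
`i = min ℐ`, `j = min 𝒥`, and `y` is an admissible monomial of degree `m` in `P_{k-2}`. -/
def genSet (k d₀ d m : ℕ) (B : Set (SeqPair k d₀)) : Set (P k) :=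
  {g | ∃ p ∈ B, ∃ y ∈ admissibleMonomials (k - 2) m,
    g = mon (seqExp p) * mon (exceptExp k (seqMin p.1) (seqMin p.2)) ^ (2 ^ d - 2 ^ d₀) *
      skip₂ k (seqMin p.1) (seqMin p.2) (mon y) ^ 2 ^ d}

/-- The function `β_k : ℤ → ℤ`. -/
def beta (k : ℕ) (t : ℤ) : ℤ := if Even (t - k + 2) then (t - k + 2) / 2 else 0

end HitProblem

namespace HitProblem

open MvPolynomial

/-! ### Elementary properties of the Steenrod squares -/

/-! The argument is dual. Every generator has degree n and some variable with even exponent, so its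
class lies in the kernel. For the converse it suffices that a linear functional Z in degree n that
kills hit polynomials and the generating set also kills every f with φ(f) hit (`span_genSet`).

Write k = c + 2 and n_t = ∑ (2^(d_i - t) - 1). A monomial is x_S g² with x_S square-free, and g² =
Sq^(deg g) g. Moving this square across x_S (`Fn.mon_mul_Sq_eq_zero`) shows Z(x_S g²) = 0 unless deg
g + |S| is a sum of |S| powers of two. Counting binary digits of n_t + c - 1 excludes |S| < c, and
parity leaves |S| = c, where g ↦ Z(x_S g²) is of the same kind in degree n_(t+1), and |S| = k, where
a second kind of functional (`IsA`) arises. Iterating over the bits, Z kills each monomial whose low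
bits have too small a weight or partial degree (`IsK.eq_zero_of_weight`, `eq_zero_of_partialDeg`).
Hence the congruence in the definition of compatibility may be used on any d₀ consecutive bits,
whatever stands in the others (`IsK.mul_two_pow_eq_zero`, `Fn.val_eq_zero_of_replaces`).

Such a replacement in a product ∏ X_{s m}^(2^m) · y^(2^D) never raises the least indices, and by the
bound on reduced lengths the two top bits of the new window agree. Sliding windows either lowers the
least pair (i, j) or spreads it over all bits from d₀ - 2 on, with an element of ℬ in the lowest
window (`Fn.val_eq_zero_of_phases`). A Sq¹ relation then moves x_i and x_j out of y at the expense
of the top bit alone. When y avoids both variables, admissible monomials of P_{k-2} finish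
(`Fn.val_eq_zero`). So Z kills all these products; a last Sq¹ relation gives Z(X_{a,b} y²) = 0 for
all y, and Z then factors as α ∘ φ with α killing hit polynomials (`IsK.eq_zero_of_phi_mem_hit`). -/

theorem mon_induct {k : ℕ} {motive : (Fin k →₀ ℕ) → Prop} (zero : motive 0)
    (step : ∀ a i, motive a → motive (Finsupp.single i 1 + a)) (a : Fin k →₀ ℕ) : motive a := by
  have h : ∀ s : Multiset (Fin k), motive (Multiset.toFinsupp s) := by
    intro s
    induction s using Multiset.induction with
    | empty => simpa using zero
    | cons i s ih =>
      rw [← Multiset.singleton_add, map_add, Multiset.toFinsupp_singleton]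
      exact step _ _ ih
  have := h (Finsupp.toMultiset a)
  simpa using this

theorem mon_zero {k : ℕ} : (mon 0 : P k) = 1 := rfl

theorem mon_single_add {k : ℕ} (i : Fin k) (a : Fin k →₀ ℕ) :
    (mon (Finsupp.single i 1 + a) : P k) = X i * mon a := by
  rw [← mon_mul]; rfl

theorem mon_pow {k : ℕ} (a : Fin k →₀ ℕ) (n : ℕ) : (mon a : P k) ^ n = mon (n • a) := by
  simp [mon, monomial_pow]

theorem Sq_zero {k : ℕ} (f : P k) : Sq k 0 f = f := by
  have : Sq k 0 = LinearMap.id := by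
    apply lin_ext
    intro a
    induction a using mon_induct with
    | zero => simp [Sq_apply, mon_zero]
    | step a i ih =>
      rw [mon_single_add, Sq_mul]
      rw [Finset.Nat.antidiagonal_zero, Finset.sum_singleton]
      rw [ih]
      simp [Sq_apply, totalSq]
  rw [this]; rfl

theorem totalSq_X_pow_two_pow {k : ℕ} (i : Fin k) (t : ℕ) :
    totalSq k (X i ^ 2 ^ t) =
      Polynomial.C (X i ^ 2 ^ t) + Polynomial.C (X i ^ 2 ^ (t + 1)) * Polynomial.X ^ 2 ^ t := by
  rw [map_pow, totalSq, aeval_X, add_pow_char_pow (p := 2), mul_pow, ← map_pow, ← map_pow,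
    ← pow_mul, pow_succ' 2 t]

theorem Sq_X_pow_mul {k : ℕ} (i : Fin k) (t n : ℕ) (f : P k) :
    Sq k n (X i ^ 2 ^ t * f) = X i ^ 2 ^ t * Sq k n f +
      if 2 ^ t ≤ n then X i ^ 2 ^ (t + 1) * Sq k (n - 2 ^ t) f else 0 := by
  simp only [Sq_apply]
  rw [map_mul, totalSq_X_pow_two_pow, add_mul, Polynomial.coeff_add, Polynomial.coeff_C_mul,
    mul_assoc, Polynomial.coeff_C_mul, Polynomial.coeff_X_pow_mul']
  simp

theorem Sq_X_mul {k : ℕ} (i : Fin k) (n : ℕ) (f : P k) :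
    Sq k (n + 1) (X i * f) = X i * Sq k (n + 1) f + X i ^ 2 * Sq k n f := by
  have := Sq_X_pow_mul i 0 (n + 1) f
  simpa using this

/-- Proved together: multiplication by a variable raises the degree by one, and the value at the new
top degree uses the vanishing just above the old one. -/
theorem Sq_mon_of_lt {k : ℕ} (a : Fin k →₀ ℕ) :
    (∀ n, a.degree < n → Sq k n (mon a) = 0) ∧ Sq k a.degree (mon a) = mon a ^ 2 := by
  induction a using mon_induct with
  | zero =>
    refine ⟨fun n hn => ?_, ?_⟩
    · have hn : n ≠ 0 := by rintro rfl; simp at hn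
      rw [mon_zero, Sq_apply, map_one, Polynomial.coeff_one, if_neg hn]
    · simp [Sq_zero, mon_zero]
  | step a i ih =>
    rw [mon_single_add]
    have hd : (Finsupp.single i 1 + a).degree = a.degree + 1 := by
      rw [map_add, Finsupp.degree_single, add_comm]
    rw [hd]
    refine ⟨fun n hn => ?_, ?_⟩
    · obtain ⟨n, rfl⟩ : ∃ m, n = m + 1 := ⟨n - 1, by omega⟩
      rw [Sq_X_mul, ih.1 _ (by omega), ih.1 _ (by omega)]
      simp
    · rw [Sq_X_mul, ih.1 _ (by omega), ih.2]
      ring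

theorem Sq_degree_mon {k : ℕ} {j : ℕ} (a : Fin k →₀ ℕ) (h : a.degree = j) :
    Sq k j (mon a) = mon a ^ 2 := by
  subst h; exact (Sq_mon_of_lt a).2

theorem mon_isHomogeneous {k : ℕ} (a : Fin k →₀ ℕ) : (mon a : P k).IsHomogeneous a.degree :=
  isHomogeneous_monomial _ rfl

theorem Sq_mon_isHomogeneous {k : ℕ} (n : ℕ) (a : Fin k →₀ ℕ) :
    (Sq k n (mon a)).IsHomogeneous (a.degree + n) := by
  induction a using mon_induct generalizing n with
  | zero =>
    rcases Nat.eq_zero_or_pos n with rfl | hn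
    · rw [Sq_zero]; exact mon_isHomogeneous _
    · rw [(Sq_mon_of_lt _).1 n (by simpa using hn)]; exact isHomogeneous_zero _ _ _
  | step a i ih =>
    rcases Nat.eq_zero_or_pos n with rfl | hn
    · rw [Sq_zero]; exact mon_isHomogeneous _
    · obtain ⟨n, rfl⟩ : ∃ m, n = m + 1 := ⟨n - 1, by omega⟩
      have hd : (Finsupp.single i 1 + a).degree = a.degree + 1 := by
        rw [map_add, Finsupp.degree_single, add_comm]
      rw [mon_single_add, Sq_X_mul, hd]
      refine IsHomogeneous.add ?_ ?_
      · have := (isHomogeneous_X (ZMod 2) i).mul (ih (n + 1))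
        convert this using 1; ring
      · have := ((isHomogeneous_X (ZMod 2) i).pow 2).mul (ih n)
        convert this using 1; ring

/-- `Sq¹ Sqⁿ = (n + 1) Sqⁿ⁺¹`. -/
theorem Sq_one_Sq {k : ℕ} (n : ℕ) (f : P k) :
    Sq k 1 (Sq k n f) = if Even n then Sq k (n + 1) f else 0 := by
  have : ∀ n, (Sq k 1).comp (Sq k n) = if Even n then Sq k (n + 1) else 0 := by
    intro n
    apply lin_ext
    intro a
    induction a using mon_induct generalizing n with
    | zero =>
      have h1 : ∀ j, 0 < j → Sq k j (mon 0) = 0 := fun j hj => (Sq_mon_of_lt 0).1 j (by simpa using hj)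
      rcases Nat.eq_zero_or_pos n with rfl | hn
      · simp [Sq_zero]
      · rw [LinearMap.comp_apply, h1 n hn, map_zero]
        split_ifs
        · rw [h1 _ (by omega)]
        · simp
    | step a i ih =>
      rcases Nat.eq_zero_or_pos n with rfl | hn
      · simp [Sq_zero]
      · obtain ⟨n, rfl⟩ : ∃ m, n = m + 1 := ⟨n - 1, by omega⟩
        have e0 : ∀ g : P k, Sq k 1 (X i * g) = X i * Sq k 1 g + X i ^ 2 * g := by
          intro g; rw [Sq_X_mul, Sq_zero]
        have e1 : ∀ g : P k, Sq k 1 (X i ^ 2 * g) = X i ^ 2 * Sq k 1 g := by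
          intro g
          have := Sq_X_pow_mul i 1 1 g
          simpa using this
        have i1 := ih (n + 1)
        have i0 := ih n
        simp only [LinearMap.comp_apply] at i0 i1
        rw [mon_single_add, LinearMap.comp_apply, Sq_X_mul, map_add, e0, e1, i1, i0]
        have hv : ∀ g : P k, g + g = 0 := fun g => CharTwo.add_self_eq_zero g
        by_cases hn' : Even n
        · have h2 : ¬ Even (n + 1) := by simpa [parity_simps] using hn'
          rw [if_neg h2, if_pos hn']
          simp [hv]
        · have h2 : Even (n + 1) := by simpa [parity_simps] using hn'
          rw [if_pos h2, if_neg hn', Sq_X_mul]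
          simp
  have h := LinearMap.congr_fun (this n) f
  rw [LinearMap.comp_apply] at h
  rw [h]; split_ifs <;> rfl

theorem Sq_one_sq_mul {k : ℕ} (f g : P k) : Sq k 1 (f * g ^ 2) = Sq k 1 f * g ^ 2 := by
  rw [Sq_mul]
  simp [Finset.Nat.antidiagonal_succ, Sq_zero, Sq_sq]

/-- `Sqᵐ` is linear over the `2^r`-th powers when `m < 2^r`. -/
theorem Sq_mul_two_pow {k : ℕ} (r m : ℕ) (hm : m < 2 ^ r) (f g : P k) :
    Sq k m (f * g ^ 2 ^ r) = Sq k m f * g ^ 2 ^ r := by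
  have h : ∀ r m, 0 < m → m < 2 ^ r → Sq k m (g ^ 2 ^ r) = 0 := by
    intro r
    induction r with
    | zero => intro m h1 h2; omega
    | succ r ih =>
      intro m h1 h2
      rw [pow_succ, pow_mul, Sq_sq]
      split_ifs with h
      · rw [ih (m / 2) (by omega) (by rw [pow_succ] at h2; omega)]; simp
      · rfl
  rw [Sq_mul, Finset.sum_eq_single (m, 0)]
  · simp [Sq_zero]
  · rintro ⟨p, q⟩ hpq hne
    rw [Finset.HasAntidiagonal.mem_antidiagonal] at hpq
    simp only at hpq
    rcases Nat.eq_zero_or_pos q with rfl | hq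
    · exact absurd (by simp_all) hne
    · rw [h r q hq (by omega), mul_zero]
  · simp

theorem Sq_rename {k l : ℕ} (f : Fin k → Fin l) (n : ℕ) (p : P k) :
    Sq l n (rename f p) = rename f (Sq k n p) := by
  have h : (totalSq l).comp (rename f) =
      (Polynomial.mapAlgHom (rename f)).comp (totalSq k) := by
    apply MvPolynomial.algHom_ext
    intro i
    simp [totalSq]
  have h2 := DFunLike.congr_fun h p
  simp only [AlgHom.comp_apply] at h2
  rw [Sq_apply, h2, Sq_apply, Polynomial.coe_mapAlgHom, Polynomial.coeff_map]
  rfl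

/-- The product of the variables with index in `S`. -/
noncomputable def sqf {k : ℕ} (S : Finset (Fin k)) : P k := ∏ i ∈ S, X i

theorem sqf_eq_mon {k : ℕ} (S : Finset (Fin k)) :
    (sqf S : P k) = mon (Finsupp.indicator S fun _ _ => 1) := by
  rw [sqf, prod_X_eq_mon]
  congr 1
  ext i
  simp [Finsupp.indicator_apply]

theorem degree_indicator_one {k : ℕ} (S : Finset (Fin k)) :
    (Finsupp.indicator S fun _ _ => 1 : Fin k →₀ ℕ).degree = S.card := by
  rw [Finsupp.degree_eq_sum]
  simp [Finsupp.indicator_apply]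

/-- The total square of `sqf S` chooses the subset T of variables that get squared, at cost |T|; the
remaining 2a - |T| must be even to act on u². -/
theorem Sq_sqf_mul_sq {k : ℕ} (S : Finset (Fin k)) (a : ℕ) (u : P k) :
    Sq k (2 * a) (sqf S * u ^ 2) = ∑ T ∈ S.powerset,
      if Even T.card ∧ T.card ≤ 2 * a then
        sqf (S \ T) * (sqf T * Sq k (a - T.card / 2) u) ^ 2 else 0 := by
  have h1 : totalSq k (sqf S) = ∑ T ∈ S.powerset,
      Polynomial.C (sqf (S \ T) * sqf T ^ 2) * Polynomial.X ^ T.card := by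
    rw [sqf, map_prod]
    simp only [totalSq, MvPolynomial.aeval_X]
    simp_rw [add_comm (Polynomial.C (X _))]
    rw [Finset.prod_add]
    refine Finset.sum_congr rfl fun t _ => ?_
    rw [Finset.prod_mul_distrib, Finset.prod_const, ← map_prod, ← map_prod, Finset.prod_pow,
      map_mul, sqf, sqf]
    ring
  rw [Sq_apply, map_mul, h1, Finset.sum_mul, Polynomial.finsetSum_coeff]
  refine Finset.sum_congr rfl fun T _ => ?_
  rw [mul_assoc, Polynomial.coeff_C_mul, Polynomial.coeff_X_pow_mul', ← Sq_apply, Sq_sq]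
  by_cases h : T.card ≤ 2 * a
  · by_cases h2 : Even T.card
    · obtain ⟨b, hb⟩ := h2
      rw [if_pos h, if_pos (by omega), if_pos ⟨⟨b, hb⟩, h⟩]
      have : (2 * a - T.card) / 2 = a - T.card / 2 := by omega
      rw [this]; ring
    · rw [if_pos h, if_neg (c := 2 ∣ _), if_neg (fun h' => h2 h'.1), mul_zero]
      rw [Nat.even_iff] at h2
      omega
  · rw [if_neg h, if_neg (fun h' => h h'.2), mul_zero]

/-! ### Sums of powers of two -/

/-- `N` is a sum of `e` powers of two. -/
def PowSum : ℕ → ℕ → Prop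
  | 0, N => N = 0
  | e + 1, N => ∃ t, 2 ^ t ≤ N ∧ PowSum e (N - 2 ^ t)

theorem PowSum.step {e N : ℕ} (t : ℕ) (h : PowSum e N) : PowSum (e + 1) (N + 2 ^ t) :=
  ⟨t, by omega, by simpa using h⟩

theorem PowSum.add_ones {e N : ℕ} (h : PowSum e N) (s : ℕ) : PowSum (e + s) (N + s) := by
  induction s with
  | zero => exact h
  | succ s ih => exact ih.step 0

theorem powSum_self (e : ℕ) : PowSum e e := by
  have := PowSum.add_ones (e := 0) (N := 0) rfl e
  simpa using this

/-- The number of digits `1` in the binary expansion. -/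
def digitSum (n : ℕ) : ℕ := (Nat.digits 2 n).sum

theorem digitSum_double (n : ℕ) : digitSum (2 * n) = digitSum n := by
  rcases Nat.eq_zero_or_pos n with rfl | hn
  · rfl
  · rw [digitSum, Nat.digits_def' (by norm_num) (by omega)]
    simp [digitSum]

theorem digitSum_double_succ (n : ℕ) : digitSum (2 * n + 1) = digitSum n + 1 := by
  rw [digitSum, Nat.digits_def' (by norm_num) (by omega)]
  have h1 : (2 * n + 1) % 2 = 1 := by omega
  have h2 : (2 * n + 1) / 2 = n := by omega
  rw [h1, h2, List.sum_cons, digitSum, add_comm]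

theorem digitSum_add_two_pow_le (t n : ℕ) : digitSum (n + 2 ^ t) ≤ digitSum n + 1 := by
  induction t generalizing n with
  | zero =>
    induction n using Nat.strong_induction_on with
    | _ n ih =>
      rcases Nat.even_or_odd' n with ⟨m, rfl | rfl⟩
      · rw [pow_zero, digitSum_double_succ, digitSum_double]
      · rw [pow_zero, show 2 * m + 1 + 1 = 2 * (m + 1) by ring, digitSum_double,
          digitSum_double_succ]
        have := ih m (by omega)
        simp only [pow_zero] at this
        omega
  | succ t ih =>
    rcases Nat.even_or_odd' n with ⟨m, rfl | rfl⟩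
    · rw [show 2 * m + 2 ^ (t + 1) = 2 * (m + 2 ^ t) by ring, digitSum_double, digitSum_double]
      exact ih m
    · rw [show 2 * m + 1 + 2 ^ (t + 1) = 2 * (m + 2 ^ t) + 1 by ring, digitSum_double_succ,
        digitSum_double_succ]
      have := ih m
      omega

theorem digitSum_add_two_pow (t n : ℕ) (h : n < 2 ^ t) : digitSum (n + 2 ^ t) = digitSum n + 1 := by
  induction t generalizing n with
  | zero =>
    have : n = 0 := by simpa using h
    subst this; simp [digitSum]
  | succ t ih =>
    rw [pow_succ] at h
    rcases Nat.even_or_odd' n with ⟨m, rfl | rfl⟩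
    · rw [show 2 * m + 2 ^ (t + 1) = 2 * (m + 2 ^ t) by ring, digitSum_double, digitSum_double]
      exact ih m (by omega)
    · rw [show 2 * m + 1 + 2 ^ (t + 1) = 2 * (m + 2 ^ t) + 1 by ring, digitSum_double_succ,
        digitSum_double_succ, ih m (by omega)]

theorem PowSum.digitSum_le {e N : ℕ} (h : PowSum e N) : digitSum N ≤ e := by
  induction e generalizing N with
  | zero =>
    rw [show N = 0 from h]; simp [digitSum]
  | succ e ih =>
    obtain ⟨t, ht, h⟩ := h
    have h1 := ih h
    have h2 := digitSum_add_two_pow_le t (N - 2 ^ t)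
    rw [Nat.sub_add_cancel ht] at h2
    omega

theorem digitSum_two_pow_sub_one (b : ℕ) : digitSum (2 ^ b - 1) = b := by
  induction b with
  | zero => simp [digitSum]
  | succ b ih =>
    have : 2 ^ (b + 1) - 1 = 2 * (2 ^ b - 1) + 1 := by
      have := Nat.one_le_two_pow (n := b)
      rw [pow_succ]; omega
    rw [this, digitSum_double_succ, ih]

/-- Distinct exponents that are at least b cause no carries with the b ones of 2^b - 1. -/
theorem digitSum_sum_two_pow (b : ℕ) (g : ℕ → ℕ) (N : ℕ) (h0 : 0 < N → b ≤ g 0)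
    (hg : ∀ i, i + 1 < N → g i < g (i + 1)) :
    digitSum (2 ^ b - 1 + ∑ i ∈ Finset.range N, 2 ^ g i) = b + N := by
  have key : ∀ M, M ≤ N → digitSum (2 ^ b - 1 + ∑ i ∈ Finset.range M, 2 ^ g i) = b + M ∧
      (M < N → 2 ^ b - 1 + ∑ i ∈ Finset.range M, 2 ^ g i < 2 ^ g M) := by
    intro M
    induction M with
    | zero =>
      intro _
      refine ⟨by simp [digitSum_two_pow_sub_one], fun h => ?_⟩
      have h1 := Nat.pow_le_pow_right (n := 2) (by norm_num) (h0 h)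
      have := Nat.one_le_two_pow (n := b)
      simp; omega
    | succ M ih =>
      intro hM
      obtain ⟨i1, i2⟩ := ih (by omega)
      have i2 := i2 (by omega)
      rw [Finset.sum_range_succ, ← add_assoc]
      refine ⟨by rw [digitSum_add_two_pow _ _ i2, i1]; ring, fun h => ?_⟩
      have := Nat.pow_le_pow_right (n := 2) (by norm_num) (hg M (by omega))
      rw [Nat.succ_eq_add_one, pow_succ] at this
      omega
  exact (key N le_rfl).1

/-- A number of summands `2^b` with exponents `g 0 < ⋯ < g (N - 1)` and `b ≤ g 0`. -/
theorem le_of_powSum {b N : ℕ} {g : ℕ → ℕ} (h0 : 0 < N → b ≤ g 0)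
    (hg : ∀ i, i + 1 < N → g i < g (i + 1)) {e M s : ℕ} (hs : 1 ≤ s) (he : PowSum e M)
    (hM : M + s = 2 ^ b + ∑ i ∈ Finset.range N, 2 ^ g i) : b + N + 1 ≤ e + s := by
  -- One unit turns 2^b into 2^b - 1, which has b digits; the other s - 1 units count as powers of
  -- two next to M.
  obtain ⟨s, rfl⟩ : ∃ r, s = r + 1 := ⟨s - 1, by omega⟩
  have h1 := (he.add_ones s).digitSum_le
  have h2 := digitSum_sum_two_pow b g N h0 hg
  have h3 : M + s = 2 ^ b - 1 + ∑ i ∈ Finset.range N, 2 ^ g i := by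
    have := Nat.one_le_two_pow (n := b)
    omega
  rw [h3, h2] at h1
  omega

/-! ### Moving Steenrod squares off a functional -/

/-- Linear functionals on `P_k`. -/
abbrev Fn (k : ℕ) : Type := P k →ₗ[ZMod 2] ZMod 2

theorem Fn.ext_mon {k : ℕ} {Z : Fn k} (h : ∀ a, Z (mon a) = 0) (f : P k) : Z f = 0 := by
  have : Z = 0 := lin_ext fun a => by simpa using h a
  rw [this]; rfl

/-- By the Cartan formula for x^(2^t), x · Sq^m g is the sum over t of Sq^(m+1-2^t)(x^(2^t) g). So a
variable of the monomial is absorbed at the price of one power of two, and the comparison can fail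
only if some choice of powers uses up the square exactly, that is, if j + 1 + e is a sum of e powers
of two. -/
theorem Fn.comp_eq {k : ℕ} {α β : Fn k} (hα : ∀ i u, α (Sq k (i + 1) u) = β (Sq k i u))
    (e j : ℕ) (a : Fin k →₀ ℕ) (ha : a.degree = e) (hp : ¬ PowSum e (j + 1 + e)) (g : P k) :
    α (mon a * Sq k (j + 1) g) = β (mon a * Sq k j g) := by
  induction a using mon_induct generalizing e j g with
  | zero => rw [mon_zero, one_mul, one_mul, hα]
  | step a x ih =>
    have hd : (Finsupp.single x 1 + a).degree = a.degree + 1 := by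
      rw [map_add, Finsupp.degree_single, add_comm]
    rw [hd] at ha
    obtain ⟨e, rfl⟩ : ∃ e', e = e' + 1 := ⟨a.degree, ha.symm⟩
    rw [Nat.add_right_cancel_iff] at ha
    -- `R m t` is the remainder after t steps of this expansion of x · Sq^(m-1) g.
    set R : ℕ → ℕ → P k := fun m t => if 2 ^ t ≤ m then X x ^ 2 ^ t * Sq k (m - 2 ^ t) g else 0
      with hR
    have hstep : ∀ m t, R m t = R m (t + 1) +
        if 2 ^ t ≤ m then Sq k (m - 2 ^ t) (X x ^ 2 ^ t * g) else 0 := by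
      intro m t
      simp only [hR]
      by_cases h : 2 ^ t ≤ m
      · rw [if_pos h, if_pos h, Sq_X_pow_mul]
        have e1 : (2 ^ t ≤ m - 2 ^ t) ↔ 2 ^ (t + 1) ≤ m := by rw [pow_succ]; omega
        by_cases h2 : 2 ^ (t + 1) ≤ m
        · have e3 : m - 2 ^ t - 2 ^ t = m - 2 ^ (t + 1) := by rw [pow_succ]; omega
          rw [if_pos h2, if_pos (e1.2 h2), e3, add_comm (X x ^ 2 ^ t * _), ← add_assoc,
            CharTwo.add_self_eq_zero, zero_add]
        · rw [if_neg h2, if_neg (fun h' => h2 (e1.1 h'))]; simp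
      · rw [if_neg h, if_neg h, if_neg]
        · simp
        · intro h2; rw [pow_succ] at h2; omega
    have key : ∀ t, α (mon a * R (j + 2) 0) + β (mon a * R (j + 1) 0) =
        α (mon a * R (j + 2) t) + β (mon a * R (j + 1) t) := by
      intro t
      induction t with
      | zero => rfl
      | succ t iht =>
        rw [iht, hstep _ t, hstep (j + 1) t, mul_add, mul_add, map_add, map_add]
        have : α (mon a * if 2 ^ t ≤ j + 2 then Sq k (j + 2 - 2 ^ t) (X x ^ 2 ^ t * g) else 0) =
            β (mon a * if 2 ^ t ≤ j + 1 then Sq k (j + 1 - 2 ^ t) (X x ^ 2 ^ t * g) else 0) := by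
          by_cases h1 : 2 ^ t ≤ j + 1
          · rw [if_pos h1, if_pos (by omega)]
            have e1 : j + 2 - 2 ^ t = (j + 1 - 2 ^ t) + 1 := by omega
            rw [e1]
            apply ih e _ ha
            intro hps
            apply hp
            have := hps.step t
            convert this using 1
            omega
          · rw [if_neg h1]
            -- If 2^t = j + 2, the α-term contains Sq⁰ and has no β-partner; but then e ones and 2^t
            -- add up to the excluded number.
            by_cases h2 : 2 ^ t ≤ j + 2
            · exfalso
              apply hp
              have := (powSum_self e).step t
              convert this using 1
              omega
            · rw [if_neg h2]; simp
        rw [this]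
        have h2 : ∀ p q r : ZMod 2, p + q + (r + q) = p + r := by decide
        exact h2 _ _ _
    -- After j + 2 steps both remainders are zero, since 2^(j+2) > j + 2.
    have h0 := key (j + 2)
    have hb : j + 2 < 2 ^ (j + 2) := Nat.lt_two_pow_self
    simp only [hR] at h0
    rw [if_neg (c := 2 ^ (j + 2) ≤ j + 2) (by omega),
      if_neg (c := 2 ^ (j + 2) ≤ j + 1) (by omega), if_pos (by simp), if_pos (by simp)] at h0
    simp only [mul_zero, map_zero, add_zero, pow_zero, pow_one] at h0
    have h2 : ∀ p q : ZMod 2, p + q = 0 → p = q := by decide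
    have h3 := h2 _ _ h0
    rw [mon_single_add, mul_comm (X x), mul_assoc, mul_assoc]
    exact h3

/-- The case β = 0. It stands in for the vanishing of the conjugate square χ(Sqʲ) on monomials of
degree e. -/
theorem Fn.mon_mul_Sq_eq_zero {k : ℕ} {Z : Fn k} (hZ : ∀ i u, 0 < i → Z (Sq k i u) = 0)
    (e j : ℕ) (a : Fin k →₀ ℕ) (ha : a.degree = e) (hp : ¬ PowSum e (j + e)) (g : P k) :
    Z (mon a * Sq k j g) = 0 := by
  rcases Nat.eq_zero_or_pos j with rfl | hj
  · exact absurd (powSum_self e) (by simpa using hp)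
  · obtain ⟨j, rfl⟩ : ∃ i, j = i + 1 := ⟨j - 1, by omega⟩
    have := Fn.comp_eq (α := Z) (β := 0) (fun i u => by simpa using hZ (i + 1) u (by omega))
      e j a ha hp g
    simpa using this

/-! ### Functionals that vanish on hit polynomials -/

/-- A sequence of degrees `n 0, n 1, …` with `n t = 2 n (t + 1) + c` for which `n t + c` is the
sum of `c` powers of two, the least of which is `2 ^ (D - t)`, in the most economical way. -/
structure DegSeq (c D : ℕ) (n : ℕ → ℕ) : Prop where
  step : ∀ t, t + 1 ≤ D → n t = 2 * n (t + 1) + c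
  le_of_powSum : ∀ t e N s, t ≤ D → 1 ≤ s → PowSum e N → N + s = n t + c → c + (D - t) ≤ e + s

/-- The functional `y ↦ Z (f y²)`. -/
noncomputable def Fn.mulSq {k : ℕ} (f : P k) (Z : Fn k) : Fn k :=
  AddMonoidHom.toZModLinearMap 2
    { toFun := fun y => Z (f * y ^ 2)
      map_zero' := by simp
      map_add' := fun x y => by rw [sq_add, mul_add, map_add] }

theorem Fn.mulSq_apply {k : ℕ} (f : P k) (Z : Fn k) (y : P k) : Z.mulSq f y = Z (f * y ^ 2) := rfl

/-- Functionals supported on degree `N` that vanish on hit polynomials. -/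
structure IsK {k : ℕ} (Z : Fn k) (N : ℕ) : Prop where
  sq : ∀ i u, 0 < i → Z (Sq k i u) = 0
  deg : ∀ a, a.degree ≠ N → Z (mon a) = 0

/-- Functionals supported on degree `N - 1` that on hit polynomials are given by functionals
supported on degree `N` that vanish on hit polynomials. -/
structure IsA {k : ℕ} (α : Fn k) (N : ℕ) : Prop where
  deg : ∀ a, a.degree + 1 ≠ N → α (mon a) = 0
  sq : ∃ (F : Finset (Finset (Fin k))) (W : Finset (Fin k) → Fn k),
    (∀ T ∈ F, T.card = 2 ∧ IsK (W T) N) ∧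
      ∀ i u, α (Sq k (i + 1) u) = ∑ T ∈ F, W T (sqf T * Sq k i u)

/-- Since α(Sq^(i+1) u) depends only on Sq^i u, α(Sq^(2i) u) equals α(Sq¹ Sq^(2i-1) u), and Sq¹
kills odd squares. -/
theorem IsA.sq_even {k N : ℕ} {α : Fn k} (h : IsA α N) (i : ℕ) (u : P k) (hi : 0 < i) :
    α (Sq k (2 * i) u) = 0 := by
  obtain ⟨F, W, -, hF⟩ := h.sq
  obtain ⟨i, rfl⟩ : ∃ j, i = j + 1 := ⟨i - 1, by omega⟩
  have h1 := hF (2 * i + 1) u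
  have h2 := hF 0 (Sq k (2 * i + 1) u)
  simp only [Sq_zero] at h2
  rw [show 2 * (i + 1) = 2 * i + 1 + 1 by ring, h1, ← h2, zero_add, Sq_one_Sq, if_neg, map_zero]
  simp [parity_simps]

theorem sqf_mul_mon_sq {k : ℕ} (S : Finset (Fin k)) (b : Fin k →₀ ℕ) :
    (sqf S * mon b ^ 2 : P k) = mon (Finsupp.indicator S (fun _ _ => 1) + 2 • b) := by
  rw [sqf_eq_mon, mon_pow, mon_mul]

theorem degree_indicator_add {k : ℕ} (S : Finset (Fin k)) (b : Fin k →₀ ℕ) :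
    (Finsupp.indicator S (fun _ _ => 1) + 2 • b : Fin k →₀ ℕ).degree = S.card + 2 * b.degree := by
  rw [map_add, degree_indicator_one, map_nsmul, smul_eq_mul]

theorem IsK.sqf_mul_sq {k N : ℕ} {Z : Fn k} (hZ : IsK Z N) {S : Finset (Fin k)} {b : Fin k →₀ ℕ}
    (h : S.card + 2 * b.degree ≠ N) : Z (sqf S * mon b ^ 2) = 0 := by
  rw [sqf_mul_mon_sq]
  exact hZ.deg _ (by rwa [degree_indicator_add])

theorem IsA.sqf_mul_sq {k N : ℕ} {Z : Fn k} (hZ : IsA Z N) {S : Finset (Fin k)} {b : Fin k →₀ ℕ}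
    (h : S.card + 2 * b.degree + 1 ≠ N) : Z (sqf S * mon b ^ 2) = 0 := by
  rw [sqf_mul_mon_sq]
  exact hZ.deg _ (by rwa [degree_indicator_add])

/-- As b² = Sq^(deg b) b, a non-zero value needs deg b + |S| to be a sum of |S| powers of two. That
number falls short of `n (t + 1) + c` by (c - |S|)/2, too few units for the digits demanded by
`DegSeq.le_of_powSum`. -/
theorem IsK.mulSq_sqf_eq_zero {k c D t : ℕ} {n : ℕ → ℕ} (hn : DegSeq c D n) {Z : Fn k}
    (hZ : IsK Z (n t)) (ht : t + 1 ≤ D) {S : Finset (Fin k)} (hS : S.card < c) :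
    Z.mulSq (sqf S) = 0 := by
  apply lin_ext
  intro b
  simp only [LinearMap.zero_apply, Fn.mulSq_apply]
  by_cases h : S.card + 2 * b.degree = n t
  · rw [← Sq_degree_mon b rfl, sqf_eq_mon]
    apply Fn.mon_mul_Sq_eq_zero hZ.sq S.card b.degree _ (degree_indicator_one S)
    intro hp
    have h1 := hn.step t ht
    have := hn.le_of_powSum (t + 1) S.card _ (b.degree - n (t + 1)) ht (by omega) hp (by omega)
    omega
  · exact hZ.sqf_mul_sq h

/-- The same count, for each `W T` with the two variables of T joined to those of S. They weaken the
bound: for |S| = c - 3 it is contradictory only when t + 1 < D, whence `hs`. -/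
theorem IsA.mulSq_sqf_eq_zero {k c D t : ℕ} {n : ℕ → ℕ} (hn : DegSeq c D n) {α : Fn k}
    (hα : IsA α (n t)) (ht : t + 1 ≤ D) {S : Finset (Fin k)} (hS : S.card + 3 ≤ c)
    (hs : S.card + 5 ≤ c ∨ t + 1 < D) : α.mulSq (sqf S) = 0 := by
  apply lin_ext
  intro b
  simp only [LinearMap.zero_apply, Fn.mulSq_apply]
  by_cases h : S.card + 2 * b.degree + 1 = n t
  · obtain ⟨F, W, hW, hF⟩ := hα.sq
    have h1 := hn.step t ht
    set β : Fn k := ∑ T ∈ F, (W T).comp (LinearMap.mulLeft (ZMod 2) (sqf T)) with hβ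
    have hβ' : ∀ u, β u = ∑ T ∈ F, W T (sqf T * u) := by
      intro u; rw [hβ]; simp
    obtain ⟨j, hj⟩ : ∃ j, b.degree = j + 1 := ⟨b.degree - 1, by omega⟩
    rw [← Sq_degree_mon b hj, sqf_eq_mon,
      Fn.comp_eq (β := β) (fun i u => by rw [hF, hβ']) S.card j _ (degree_indicator_one S), hβ']
    · refine Finset.sum_eq_zero fun T hT => ?_
      obtain ⟨hT2, hTK⟩ := hW T hT
      rw [← mul_assoc, sqf_eq_mon, mon_mul]
      apply Fn.mon_mul_Sq_eq_zero hTK.sq (S.card + 2) j _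
        (by rw [map_add, degree_indicator_one, degree_indicator_one, hT2, add_comm])
      intro hp
      have := hn.le_of_powSum (t + 1) _ _ (b.degree - n (t + 1)) ht (by omega) hp (by omega)
      omega
    · intro hp
      have := hn.le_of_powSum (t + 1) _ _ (b.degree + 1 - n (t + 1)) ht (by omega) hp (by omega)
      omega
  · exact hα.sqf_mul_sq h

theorem Fn.sum_mulSq_eq_zero {k : ℕ} {Z : Fn k} (hZ : ∀ i u, 0 < i → Z (Sq k (2 * i) u) = 0)
    (S : Finset (Fin k)) (i : ℕ) (u : P k) :
    Z.mulSq (sqf S) (Sq k (i + 1) u) = ∑ T ∈ S.powerset.erase ∅,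
      if Even T.card ∧ T.card ≤ 2 * (i + 1) then
        Z.mulSq (sqf (S \ T)) (sqf T * Sq k (i + 1 - T.card / 2) u) else 0 := by
  have h := hZ (i + 1) (sqf S * u ^ 2) (by omega)
  rw [Sq_sqf_mul_sq, map_sum, ← Finset.add_sum_erase _ _ (Finset.empty_mem_powerset S)] at h
  have h2 : ∀ p q : ZMod 2, p + q = 0 → p = q := by decide
  have h3 := h2 _ _ h
  have e : (sqf (∅ : Finset (Fin k)) : P k) = 1 := rfl
  simp only [Finset.card_empty, Finset.sdiff_empty, e, one_mul] at h3
  rw [if_pos (by simp)] at h3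
  simp only [Nat.zero_div, Nat.sub_zero] at h3
  rw [Fn.mulSq_apply, h3]
  refine Finset.sum_congr rfl fun T _ => ?_
  split_ifs
  · rfl
  · simp

theorem Fn.mulSq_sqf_Sq_eq_zero {k : ℕ} {Z : Fn k}
    (hZ : ∀ i u, 0 < i → Z (Sq k (2 * i) u) = 0) (S : Finset (Fin k))
    (hS : ∀ T ⊆ S, 2 ≤ T.card → Z.mulSq (sqf (S \ T)) = 0) (i : ℕ) (u : P k) :
    Z.mulSq (sqf S) (Sq k (i + 1) u) = 0 := by
  rw [Fn.sum_mulSq_eq_zero hZ]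
  refine Finset.sum_eq_zero fun T hT => ?_
  rw [Finset.mem_erase, Finset.mem_powerset] at hT
  split_ifs with h
  · rw [hS T hT.2]
    · rfl
    · have := Finset.card_ne_zero.2 (Finset.nonempty_iff_ne_empty.2 hT.1)
      obtain ⟨r, hr⟩ := h.1
      omega
  · rfl

/-- Only two-element sets T survive, and they lower Sq^(i+1) to Sq^i: this is the origin of `IsA`.
-/
theorem Fn.mulSq_sqf_Sq {k : ℕ} {Z : Fn k}
    (hZ : ∀ i u, 0 < i → Z (Sq k (2 * i) u) = 0) (S : Finset (Fin k))
    (hS : ∀ T ⊆ S, 4 ≤ T.card → Z.mulSq (sqf (S \ T)) = 0) (i : ℕ) (u : P k) :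
    Z.mulSq (sqf S) (Sq k (i + 1) u) =
      ∑ T ∈ S.powersetCard 2, Z.mulSq (sqf (S \ T)) (sqf T * Sq k i u) := by
  rw [Fn.sum_mulSq_eq_zero hZ, ← Finset.sum_subset (s₁ := S.powersetCard 2)]
  · refine Finset.sum_congr rfl fun T hT => ?_
    rw [Finset.mem_powersetCard] at hT
    rw [hT.2, if_pos ⟨by decide, by omega⟩]
    rfl
  · intro T hT
    rw [Finset.mem_powersetCard] at hT
    rw [Finset.mem_erase, Finset.mem_powerset]
    refine ⟨?_, hT.1⟩
    rintro rfl
    simp at hT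
  · intro T hT hT2
    rw [Finset.mem_erase, Finset.mem_powerset] at hT
    rw [Finset.mem_powersetCard] at hT2
    split_ifs with h
    · rw [hS T hT.2]
      · rfl
      · have := Finset.card_ne_zero.2 (Finset.nonempty_iff_ne_empty.2 hT.1)
        obtain ⟨r, hr⟩ := h.1
        have : T.card ≠ 2 := fun h => hT2 ⟨hT.2, h⟩
        omega
    · rfl

/-! ### Stripping a square-free factor from functionals of the two kinds. -/

section

variable {k c D t : ℕ} {n : ℕ → ℕ}

theorem IsK.mulSq_sqf (hn : DegSeq c D n) {Z : Fn k} (hZ : IsK Z (n t)) (ht : t + 1 ≤ D)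
    {S : Finset (Fin k)} (hS : S.card = c) : IsK (Z.mulSq (sqf S)) (n (t + 1)) := by
  refine ⟨fun i u hi => ?_, fun a ha => hZ.sqf_mul_sq ?_⟩
  · obtain ⟨i, rfl⟩ : ∃ j, i = j + 1 := ⟨i - 1, by omega⟩
    refine Fn.mulSq_sqf_Sq_eq_zero (fun i u hi => hZ.sq _ _ (by omega)) S (fun T hT h2 => ?_) i u
    apply hZ.mulSq_sqf_eq_zero hn ht
    rw [Finset.card_sdiff_of_subset hT]
    have := Finset.card_le_card hT
    omega
  · have := hn.step t ht
    omega

theorem IsK.mulSq_univ_Sq (hn : DegSeq c D n) (hk : k = c + 2) {Z : Fn k} (hZ : IsK Z (n t))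
    (ht : t + 1 ≤ D) (i : ℕ) (u : P k) :
    Z.mulSq (sqf Finset.univ) (Sq k (i + 1) u) = ∑ T ∈ Finset.univ.powersetCard 2,
      Z.mulSq (sqf (Finset.univ \ T)) (sqf T * Sq k i u) := by
  refine Fn.mulSq_sqf_Sq (fun i u hi => hZ.sq _ _ (by omega)) _ (fun T hT h2 => ?_) i u
  apply hZ.mulSq_sqf_eq_zero hn ht
  rw [Finset.card_sdiff_of_subset hT]
  have := Finset.card_le_card hT
  simp at this ⊢
  omega

/-- Removing a pair from all k variables leaves c of them. The functional need not kill hit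
polynomials, but its values there are given by functionals that do. -/
theorem IsK.mulSq_univ (hn : DegSeq c D n) (hk : k = c + 2) {Z : Fn k} (hZ : IsK Z (n t))
    (ht : t + 1 ≤ D) : IsA (Z.mulSq (sqf Finset.univ)) (n (t + 1)) := by
  refine ⟨fun a ha => hZ.sqf_mul_sq ?_, _, fun T => Z.mulSq (sqf (Finset.univ \ T)),
    fun T hT => ?_, hZ.mulSq_univ_Sq hn hk ht⟩
  · have := hn.step t ht
    simp
    omega
  · rw [Finset.mem_powersetCard] at hT
    refine ⟨hT.2, hZ.mulSq_sqf hn ht ?_⟩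
    rw [Finset.card_sdiff_of_subset hT.1, hT.2]
    simp
    omega

/-- The degree now has the other parity: the second kind returns to the first at |S| = c - 1 and
persists at |S| = c + 1. -/
theorem IsA.mulSq_sqf (hn : DegSeq c D n) {α : Fn k} (hα : IsA α (n t))
    (ht : t + 1 < D) {S : Finset (Fin k)} (hS : S.card + 1 = c) :
    IsK (α.mulSq (sqf S)) (n (t + 1)) := by
  refine ⟨fun i u hi => ?_, fun a ha => hα.sqf_mul_sq ?_⟩
  · obtain ⟨i, rfl⟩ : ∃ j, i = j + 1 := ⟨i - 1, by omega⟩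
    refine Fn.mulSq_sqf_Sq_eq_zero hα.sq_even S (fun T hT h2 => ?_) i u
    have := Finset.card_sdiff_of_subset hT
    have := Finset.card_le_card hT
    exact hα.mulSq_sqf_eq_zero hn (by omega) (by omega) (by omega)
  · have := hn.step t (by omega)
    omega

theorem IsA.mulSq_sqf_succ (hn : DegSeq c D n) {α : Fn k} (hα : IsA α (n t))
    (ht : t + 1 < D) {S : Finset (Fin k)} (hS : S.card = c + 1) :
    IsA (α.mulSq (sqf S)) (n (t + 1)) := by
  refine ⟨fun a ha => hα.sqf_mul_sq ?_, S.powersetCard 2, fun T => α.mulSq (sqf (S \ T)),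
    fun T hT => ?_, ?_⟩
  · have := hn.step t (by omega)
    omega
  · rw [Finset.mem_powersetCard] at hT
    refine ⟨hT.2, hα.mulSq_sqf hn ht ?_⟩
    rw [Finset.card_sdiff_of_subset hT.1, hT.2]
    have := Finset.card_le_card hT.1
    omega
  · refine Fn.mulSq_sqf_Sq hα.sq_even _ (fun T hT h2 => ?_)
    have := Finset.card_sdiff_of_subset hT
    have := Finset.card_le_card hT
    exact hα.mulSq_sqf_eq_zero hn (by omega) (by omega) (by omega)

end

/-! ### Weights -/

theorem weight_apply {k : ℕ} (a : Fin k →₀ ℕ) (i : ℕ) :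
    weight a i = (Finset.univ.filter fun j => (a j).testBit i = true).card := rfl

theorem weight_le {k : ℕ} (a : Fin k →₀ ℕ) (i : ℕ) : weight a i ≤ k := by
  rw [weight_apply]
  exact (Finset.card_le_univ _).trans (by simp)

theorem exists_sqf_mul_sq {k : ℕ} (a : Fin k →₀ ℕ) :
    ∃ (S : Finset (Fin k)) (b : Fin k →₀ ℕ), (mon a : P k) = sqf S * mon b ^ 2 ∧
      S.card = weight a 0 ∧ (∀ i, weight b i = weight a (i + 1)) := by
  refine ⟨Finset.univ.filter fun j => (a j).testBit 0 = true,
    a.mapRange (fun e => e / 2) rfl, ?_, rfl, fun i => ?_⟩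
  · rw [sqf_mul_mon_sq]
    congr 1
    ext i
    simp [Finsupp.indicator_apply, Nat.testBit_zero]
    split_ifs <;> omega
  · rw [weight_apply, weight_apply]
    simp only [Nat.testBit_succ]
    rfl

/-- The partial degree `∑_{i < h} 2^i ω_i`. -/
noncomputable def partialDeg {k : ℕ} (h : ℕ) (a : Fin k →₀ ℕ) : ℕ :=
  ∑ j ∈ Finset.range h, 2 ^ j * weight a j

theorem partialDeg_succ {k h : ℕ} {a b : Fin k →₀ ℕ} (hb : ∀ i, weight b i = weight a (i + 1)) :
    partialDeg (h + 1) a = weight a 0 + 2 * partialDeg h b := by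
  rw [partialDeg, Finset.sum_range_succ', partialDeg, Finset.mul_sum, add_comm]
  simp [hb, pow_succ']
  refine Finset.sum_congr rfl fun i _ => ?_
  ring

theorem mul_two_pow_succ_sub_one (c h : ℕ) :
    c * (2 ^ (h + 1) - 1) = 2 * (c * (2 ^ h - 1)) + c := by
  obtain ⟨r, hr⟩ : ∃ r, 2 ^ h = r + 1 := ⟨2 ^ h - 1, by have := Nat.one_le_two_pow (n := h); omega⟩
  have : 2 ^ (h + 1) - 1 = 2 * r + 1 := by rw [pow_succ]; omega
  rw [this, hr, Nat.add_sub_cancel]; ring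

/-- Induction on the bits of a. A full lowest bit passes from the first kind to the second with one
surplus unit carried along, whence the `+ 1` there. The three alternatives matter only for t + h =
D, where the vanishing for the second kind needs |S| + 5 ≤ c. -/
theorem eq_zero_of_partialDeg {k c D : ℕ} {n : ℕ → ℕ} (hn : DegSeq c D n) (hk : k = c + 2)
    (h : ℕ) (t : ℕ) (ht : t + h ≤ D) (a : Fin k →₀ ℕ) :
    (∀ Z : Fn k, IsK Z (n t) → partialDeg h a < c * (2 ^ h - 1) →
      (t + h < D ∨ c ≤ 2 ∨ partialDeg h a + 2 ^ h < c * (2 ^ h - 1)) → Z (mon a) = 0) ∧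
    (∀ Z : Fn k, IsA Z (n t) → partialDeg h a + 1 < c * (2 ^ h - 1) →
      (t + h < D ∨ c ≤ 2 ∨ partialDeg h a + 1 + 2 ^ h < c * (2 ^ h - 1)) → Z (mon a) = 0) := by
  induction h generalizing t a with
  | zero => simp
  | succ h ih =>
    obtain ⟨S, b, hab, hS, hb⟩ := exists_sqf_mul_sq a
    obtain ⟨ih1, ih2⟩ := ih (t + 1) (by omega) b
    have e1 := partialDeg_succ (h := h) hb
    have e2 := mul_two_pow_succ_sub_one c h
    have e3 : 2 ^ (h + 1) = 2 * 2 ^ h := pow_succ' _ _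
    have hst := hn.step t (by omega)
    have hSk : S.card ≤ k := by rw [hS]; exact weight_le _ _
    rw [e1, e2, e3, ← hS, hab]
    refine ⟨fun Z hZ hlt hsl => ?_, fun Z hZ hlt hsl => ?_⟩
    · by_cases hp : S.card + 2 * b.degree = n t
      · obtain h1 | h1 | h1 : S.card < c ∨ S.card = c ∨ S.card = c + 2 := by omega
        · rw [← Fn.mulSq_apply, hZ.mulSq_sqf_eq_zero hn (by omega) h1]; rfl
        · exact ih1 _ (hZ.mulSq_sqf hn (by omega) h1) (by omega) (by omega)
        · have : S = Finset.univ := by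
            rw [← Finset.card_eq_iff_eq_univ, Fintype.card_fin]; omega
          subst this
          exact ih2 _ (hZ.mulSq_univ hn hk (by omega)) (by omega) (by omega)
      · exact hZ.sqf_mul_sq hp
    · by_cases hp : S.card + 2 * b.degree + 1 = n t
      -- With one bit left, the bound and parity give |S| + 3 ≤ c, and the slack gives |S| + 5 ≤ c
      -- if t + 1 = D. With more bits, t + 1 < D is automatic.
      · rcases Nat.eq_zero_or_pos h with rfl | hh
        · simp at hlt hsl
          rw [← Fn.mulSq_apply, hZ.mulSq_sqf_eq_zero hn (by omega) (by omega) (by omega)]; rfl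
        · obtain h1 | h1 | h1 : S.card + 3 ≤ c ∨ S.card + 1 = c ∨ S.card = c + 1 := by omega
          · rw [← Fn.mulSq_apply, hZ.mulSq_sqf_eq_zero hn (by omega) h1 (by omega)]; rfl
          · exact ih1 _ (hZ.mulSq_sqf hn (by omega) h1) (by omega) (by omega)
          · exact ih2 _ (hZ.mulSq_sqf_succ hn (by omega) h1) (by omega) (by omega)
      · exact hZ.sqf_mul_sq hp

/-- Bits of weight c keep the functional in the first kind; the first deficient bit kills it. -/
theorem IsK.eq_zero_of_weight {k c D : ℕ} {n : ℕ → ℕ} (hn : DegSeq c D n) (j t : ℕ)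
    (ht : t + j + 1 ≤ D) (a : Fin k →₀ ℕ) (h1 : ∀ i < j, weight a i = c) (h2 : weight a j < c)
    (Z : Fn k) (hZ : IsK Z (n t)) : Z (mon a) = 0 := by
  induction j generalizing t a Z with
  | zero =>
    obtain ⟨S, b, hab, hS, -⟩ := exists_sqf_mul_sq a
    rw [hab, ← Fn.mulSq_apply, hZ.mulSq_sqf_eq_zero hn (by omega) (by omega)]; rfl
  | succ j ih =>
    obtain ⟨S, b, hab, hS, hb⟩ := exists_sqf_mul_sq a
    rw [hab]
    exact ih (t + 1) (by omega) b (fun i hi => by rw [hb, h1 _ (by omega)]) (by rwa [hb])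
      (Z.mulSq (sqf S)) (hZ.mulSq_sqf hn (by omega) (by rw [hS, h1 _ (by omega)]))

/-! ### Partial degrees and minimal spikes -/

theorem partialDeg_eq_sum_mod {k : ℕ} (h : ℕ) (a : Fin k →₀ ℕ) :
    partialDeg h a = ∑ j, a j % 2 ^ h := by
  induction h with
  | zero => simp [partialDeg, Nat.mod_one]
  | succ h ih =>
    rw [partialDeg, Finset.sum_range_succ, ← partialDeg, ih, weight_apply, Finset.card_filter,
      Finset.mul_sum, ← Finset.sum_add_distrib]
    refine Finset.sum_congr rfl fun j _ => ?_
    rw [Nat.mod_pow_succ]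
    simp only [Nat.testBit_eq_decide_div_mod_eq, decide_eq_true_eq]
    rcases Nat.mod_two_eq_zero_or_one (a j / 2 ^ h) with h1 | h1 <;> simp [h1]

theorem partialDeg_mono {k : ℕ} {h h' : ℕ} (hh : h ≤ h') (a : Fin k →₀ ℕ) :
    partialDeg h a ≤ partialDeg h' a :=
  Finset.sum_le_sum_of_subset (Finset.range_mono hh)

theorem exists_degree_eq {k : ℕ} (h : ℕ) (a : Fin k →₀ ℕ) :
    ∃ q, a.degree = partialDeg h a + 2 ^ h * q := by
  refine ⟨∑ j, a j / 2 ^ h, ?_⟩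
  rw [partialDeg_eq_sum_mod, Finset.mul_sum, ← Finset.sum_add_distrib, Finsupp.degree_eq_sum]
  exact Finset.sum_congr rfl fun j _ => (Nat.mod_add_div _ _).symm

/-- Bounds ∑ 2^(s_j) for a minimal spike by its largest exponent: the other terms add up to at most
the largest one. -/
theorem two_pow_add_sum_le {b N : ℕ} {g : ℕ → ℕ} (h0 : 0 < N → b ≤ g 0)
    (hg : ∀ i, i + 1 < N → g i < g (i + 1)) {M : ℕ} (hb : b ≤ M) (hM : ∀ i < N, g i ≤ M) :
    2 ^ b + ∑ i ∈ Finset.range N, 2 ^ g i ≤ 2 ^ (M + 1) := by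
  induction N generalizing M with
  | zero => simpa using Nat.pow_le_pow_right (by norm_num) (by omega)
  | succ N ih =>
    rw [Finset.sum_range_succ, ← add_assoc]
    have h1 : 2 ^ b + ∑ i ∈ Finset.range N, 2 ^ g i ≤ 2 ^ g N := by
      rcases Nat.eq_zero_or_pos N with rfl | hN
      · simpa using Nat.pow_le_pow_right (by norm_num) (h0 (by omega))
      · have hmono : ∀ i < N, g i < g N := by
          intro i hi
          obtain ⟨r, rfl⟩ : ∃ r, N = i + 1 + r := ⟨N - (i + 1), by omega⟩
          clear ih hN hi
          induction r with
          | zero => exact hg i (by omega)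
          | succ r ihr =>
            exact (ihr (fun h => h0 (by omega)) (fun j hj => hg j (by omega))
              (fun j hj => hM j (by omega))).trans (hg (i + 1 + r) (by omega))
        have h00 := h0 (by omega)
        have := hmono 0 hN
        have := ih (M := g N - 1) (fun _ => h0 (by omega)) (fun i hi => hg i (by omega))
          (by omega) (fun i hi => by have := hmono i hi; omega)
        rwa [Nat.sub_add_cancel (by omega)] at this
    have h2 := Nat.pow_le_pow_right (n := 2) (by norm_num) (hM N (by omega))
    rw [pow_succ]
    omega

theorem sum_range_fin {k r : ℕ} (hr : r ≤ k) (f : ℕ → ℕ) (hf : ∀ j, r ≤ j → f j = 0) :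
    ∑ j : Fin k, f j = ∑ j ∈ Finset.range r, f j := by
  rw [Fin.sum_univ_eq_sum_range]
  symm
  refine Finset.sum_subset (Finset.range_mono hr) fun j _ hj => hf j ?_
  simpa using hj

/-- The comparison is with the spike of the same degree having c exponents 2^d₀ - 1. A minimal spike
has at most c positive exponents, which gives the first bound. For c ≥ 3 it is another spike: at
most its two least exponents coincide, so some s_j exceeds d₀ and at least 2^d₀ of the degree lies
in higher bits. -/
theorem IsMinimalSpike.partialDeg_le {k c d₀ : ℕ} (hk : k = c + 2) (hd₀ : 2 < d₀)
    {z : Fin k →₀ ℕ} (hz : IsMinimalSpike z) (hd : z.degree = c * (2 ^ d₀ - 1)) :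
    (∀ h, partialDeg h z ≤ c * (2 ^ h - 1)) ∧
      (3 ≤ c → partialDeg d₀ z + 2 ^ d₀ ≤ c * (2 ^ d₀ - 1)) := by
  obtain ⟨s, r, hrk, hzs, hs1, hs2, hs3, hs4⟩ := hz
  have hpow : 8 ≤ 2 ^ d₀ := by
    simpa using Nat.pow_le_pow_right (n := 2) (by norm_num) (Nat.succ_le_of_lt hd₀)
  have hsum : ∑ j ∈ Finset.range r, (2 ^ s j - 1) = c * (2 ^ d₀ - 1) := by
    rw [← hd, Finsupp.degree_eq_sum, ← sum_range_fin hrk (fun j => 2 ^ s j - 1)]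
    · exact Finset.sum_congr rfl fun j _ => (hzs j).symm
    · intro j hj; simp [hs4 j hj]
  have hsum2 : ∑ j ∈ Finset.range r, 2 ^ s j = c * (2 ^ d₀ - 1) + r := by
    rw [← hsum]
    have h1 : r = ∑ j ∈ Finset.range r, 1 := by simp
    conv_rhs => rw [add_comm]; lhs; rw [h1]
    rw [← Finset.sum_add_distrib]
    refine Finset.sum_congr rfl fun j _ => ?_
    have := Nat.one_le_two_pow (n := s j)
    omega
  have hc2 : c * (2 ^ d₀ - 1) + c = c * 2 ^ d₀ := by
    rw [← Nat.mul_succ]; congr 1; omega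
  -- The exponents are listed in increasing order, the least one `s (r - 1)`, which may be repeated,
  -- being set apart.
  have hsplit : 0 < r → 2 ^ s (r - 1) + ∑ i ∈ Finset.range (r - 1), 2 ^ s (r - 2 - i) =
      c * (2 ^ d₀ - 1) + r := by
    intro hr
    rw [← hsum2]
    obtain ⟨r, rfl⟩ : ∃ j, r = j + 1 := ⟨r - 1, by omega⟩
    rw [Finset.sum_range_succ, ← Finset.sum_range_reflect, add_comm]
    simp only [Nat.add_sub_cancel]
    congr 1
    refine Finset.sum_congr rfl fun j hj => ?_
    rw [Finset.mem_range] at hj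
    rw [show r + 1 - 2 - (r - 1 - j) = j by omega]
  have hg0 : 0 < r - 1 → s (r - 1) ≤ s (r - 2 - 0) := by
    intro hr
    have := hs2 (r - 2) (by omega)
    rwa [show r - 2 + 1 = r - 1 by omega] at this
  have hg1 : ∀ i, i + 1 < r - 1 → s (r - 2 - i) < s (r - 2 - (i + 1)) := by
    intro i hi
    have := hs1 (r - 2 - (i + 1)) (by omega)
    rwa [show r - 2 - (i + 1) + 1 = r - 2 - i by omega] at this
  have hpar : r % 2 = c % 2 := by
    have h1 : Even (∑ j ∈ Finset.range r, 2 ^ s j) := by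
      refine Finset.even_sum _ fun j hj => ?_
      have := hs3 j (Finset.mem_range.1 hj)
      exact Nat.even_pow.2 ⟨even_two, by omega⟩
    have h2 : Even (c * 2 ^ d₀) := Even.mul_left ((Nat.even_pow).2 ⟨even_two, by omega⟩) c
    rw [hsum2] at h1
    rw [Nat.even_iff] at h1 h2
    omega
  have hrc : r ≤ c := by
    by_contra hcon
    have hr : r = c + 2 := by omega
    -- Here ∑ 2^(s_j) = c · 2^d₀ + 2 has c + 2 terms; comparison with c copies of 2^d₀ and two units
    -- would force `s (r - 1) = 0`.
    have hps : PowSum c (c * 2 ^ d₀) := by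
      have : ∀ e, PowSum e (e * 2 ^ d₀) := by
        intro e
        induction e with
        | zero => simp [PowSum]
        | succ e ih => rw [Nat.succ_mul]; exact ih.step d₀
      exact this c
    have := le_of_powSum (s := 2) hg0 hg1 (by norm_num) hps (by rw [hsplit (by omega)]; omega)
    have := hs3 (r - 1) (by omega)
    omega
  refine ⟨fun h => ?_, fun hc => ?_⟩
  · rw [partialDeg_eq_sum_mod]
    have h1 : ∑ j, z j % 2 ^ h = ∑ j ∈ Finset.range r, (2 ^ s j - 1) % 2 ^ h := by
      rw [← sum_range_fin hrk (fun j => (2 ^ s j - 1) % 2 ^ h)]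
      · exact Finset.sum_congr rfl fun j _ => by rw [hzs]
      · intro j hj; simp [hs4 j hj]
    rw [h1]
    calc _ ≤ ∑ j ∈ Finset.range r, (2 ^ h - 1) := by
          refine Finset.sum_le_sum fun j _ => ?_
          have := Nat.mod_lt (2 ^ s j - 1) (y := 2 ^ h) (by positivity)
          omega
      _ = r * (2 ^ h - 1) := by simp
      _ ≤ _ := Nat.mul_le_mul_right _ hrc
  · have hr0 : 0 < r := by
      by_contra h0
      have : r = 0 := by omega
      subst this
      have : 3 * 7 ≤ c * (2 ^ d₀ - 1) := Nat.mul_le_mul hc (by omega)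
      simp at hsum
      omega
    obtain ⟨j, hj, hjs⟩ : ∃ j < r, d₀ < s j := by
      by_contra! hcon
      have h1 := two_pow_add_sum_le hg0 hg1 (hcon (r - 1) (by omega))
        (fun i hi => hcon (r - 2 - i) (by omega))
      rw [hsplit hr0, pow_succ] at h1
      have : 3 * (2 ^ d₀ - 1) ≤ c * (2 ^ d₀ - 1) := Nat.mul_le_mul_right _ hc
      omega
    obtain ⟨q, hq⟩ := exists_degree_eq d₀ z
    rw [← hd, hq]
    have hq0 : q ≠ 0 := by
      rintro rfl
      rw [partialDeg_eq_sum_mod, Finsupp.degree_eq_sum, mul_zero, add_zero] at hq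
      have h2 := (Finset.sum_eq_sum_iff_of_le (s := Finset.univ) (f := fun j => z j % 2 ^ d₀)
        (g := fun j => z j) (fun j _ => Nat.mod_le _ _)).1 hq.symm ⟨j, by omega⟩ (by simp)
      have h3 := Nat.mod_lt (z ⟨j, by omega⟩) (y := 2 ^ d₀) (by positivity)
      rw [h2, hzs] at h3
      have := Nat.pow_le_pow_right (n := 2) (by norm_num) hjs
      rw [Nat.succ_eq_add_one, pow_succ] at this
      simp only at h3
      omega
    have : 2 ^ d₀ * 1 ≤ 2 ^ d₀ * q := Nat.mul_le_mul_left _ (by omega)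
    omega

/-- Moves the defect to some i ≤ d₀, among the bits not touched by a factor y^(2^d₀). If h > d₀, the
slack comes from a itself, which has at least 2^(d₀+1) of its degree in bits above d₀. -/
theorem exists_partialDeg_lt {k c d₀ : ℕ} (hk : k = c + 2) (hd₀ : 2 < d₀)
    {a z : Fin k →₀ ℕ} (ha : a.degree = c * (2 ^ d₀ - 1)) (hz : IsMinimalSpike z)
    (hd : z.degree = c * (2 ^ d₀ - 1)) {h : ℕ} (hh : partialDeg h a < partialDeg h z) :
    ∃ i ≤ d₀, partialDeg i a < c * (2 ^ i - 1) ∧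
      (i < d₀ ∨ c ≤ 2 ∨ partialDeg i a + 2 ^ i < c * (2 ^ i - 1)) := by
  obtain ⟨h1, h2⟩ := hz.partialDeg_le hk hd₀ hd
  rcases lt_trichotomy h d₀ with hlt | rfl | hgt
  · exact ⟨h, hlt.le, hh.trans_le (h1 h), Or.inl hlt⟩
  · refine ⟨h, le_rfl, hh.trans_le (h1 h), ?_⟩
    by_cases hc : c ≤ 2
    · exact Or.inr (Or.inl hc)
    · have := h2 (by omega)
      exact Or.inr (Or.inr (by omega))
  · have h3 : partialDeg h z ≤ c * (2 ^ d₀ - 1) := by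
      obtain ⟨q, hq⟩ := exists_degree_eq h z
      omega
    have h4 := partialDeg_mono hgt.le a
    refine ⟨d₀, le_rfl, by omega, ?_⟩
    by_cases hc : c ≤ 2
    · exact Or.inr (Or.inl hc)
    · refine Or.inr (Or.inr ?_)
      obtain ⟨q, hq⟩ := exists_degree_eq d₀ a
      obtain ⟨q', hq'⟩ := exists_degree_eq (d₀ + 1) a
      have h5 := partialDeg_mono (h := d₀ + 1) (h' := h) hgt a
      have h6 := partialDeg_mono (Nat.le_succ d₀) a
      have hp : 0 < 2 ^ d₀ := by positivity
      have hq'0 : q' ≠ 0 := by rintro rfl; omega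
      have : 2 ^ (d₀ + 1) * 1 ≤ 2 ^ (d₀ + 1) * q' := Nat.mul_le_mul_left _ (by omega)
      rw [Nat.succ_eq_add_one] at h6
      rw [pow_succ] at this
      rw [pow_succ] at hq'
      omega

/-! ### Products of the monomials `X_{i,j}` -/

theorem exceptExp_eq {k : ℕ} (i j : Fin k) :
    exceptExp k i j = Finsupp.indicator (Finset.univ \ {i, j}) (fun _ _ => 1) := by
  ext l
  simp only [exceptExp, Finsupp.equivFunOnFinite_symm_apply_apply, Finsupp.indicator_apply,
    Finset.mem_sdiff, Finset.mem_univ, true_and, Finset.mem_insert, Finset.mem_singleton,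
    Fin.val_inj, dite_eq_ite]
  split_ifs <;> simp_all

theorem mon_exceptExp {k : ℕ} (i j : Fin k) :
    (mon (exceptExp k i j) : P k) = sqf (Finset.univ \ {i, j}) := by
  rw [exceptExp_eq, sqf_eq_mon]

theorem card_sdiff_pair {k c : ℕ} (hk : k = c + 2) {i j : Fin k} (h : i ≠ j) :
    (Finset.univ \ {i, j} : Finset (Fin k)).card = c := by
  rw [Finset.card_sdiff_of_subset (Finset.subset_univ _), Finset.card_pair h]
  simp; omega

/-- The exponent vector of `∏_{m < n} X_{s m}^{2^m}`. -/
noncomputable def pairExp {k : ℕ} (s : ℕ → Fin k × Fin k) (n : ℕ) : Fin k →₀ ℕ :=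
  ∑ m ∈ Finset.range n, 2 ^ m • exceptExp k (s m).1 (s m).2

theorem pairExp_succ {k : ℕ} (s : ℕ → Fin k × Fin k) (n : ℕ) :
    pairExp s (n + 1) = pairExp s n + 2 ^ n • exceptExp k (s n).1 (s n).2 := by
  rw [pairExp, Finset.sum_range_succ, pairExp]

theorem pairExp_succ' {k : ℕ} (s : ℕ → Fin k × Fin k) (n : ℕ) :
    pairExp s (n + 1) =
      exceptExp k (s 0).1 (s 0).2 + 2 • pairExp (fun m => s (m + 1)) n := by
  rw [pairExp, Finset.sum_range_succ', pairExp, Finset.smul_sum, add_comm]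
  simp [pow_succ', mul_smul]

theorem weight_indicator_add {k : ℕ} (S : Finset (Fin k)) (b : Fin k →₀ ℕ) :
    weight (Finsupp.indicator S (fun _ _ => 1) + 2 • b) 0 = S.card ∧
      ∀ i, weight (Finsupp.indicator S (fun _ _ => 1) + 2 • b) (i + 1) = weight b i := by
  refine ⟨?_, fun i => ?_⟩
  · rw [weight_apply]
    congr 1
    ext j
    by_cases h : j ∈ S <;> simp [Finsupp.indicator_apply, Nat.testBit_zero, h]
  · rw [weight_apply, weight_apply]
    congr 1
    ext j
    have : (if j ∈ S then 1 else 0) + 2 * b j = 2 * b j ∨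
      (if j ∈ S then 1 else 0) + 2 * b j = 2 * b j + 1 := by split_ifs <;> omega
    simp only [Finset.mem_filter, Finset.mem_univ, true_and, Finsupp.add_apply,
      Finsupp.indicator_apply, Finsupp.smul_apply, smul_eq_mul, dite_eq_ite, Nat.testBit_succ]
    rcases this with h | h <;> rw [h]
    · rw [Nat.mul_div_cancel_left _ (by norm_num)]
    · rw [show (2 * b j + 1) / 2 = b j by omega]

theorem weight_pairExp {k c : ℕ} (hk : k = c + 2) (s : ℕ → Fin k × Fin k)
    (n : ℕ) (hs : ∀ m < n, (s m).1 ≠ (s m).2) (i : ℕ) :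
    weight (pairExp s n) i = if i < n then c else 0 := by
  induction n generalizing s i with
  | zero => simp [pairExp, weight_apply]
  | succ n ih =>
    rw [pairExp_succ', exceptExp_eq]
    obtain ⟨h1, h2⟩ := weight_indicator_add (Finset.univ \ {(s 0).1, (s 0).2})
      (pairExp (fun m => s (m + 1)) n)
    cases i with
    | zero => rw [h1, card_sdiff_pair hk (hs 0 (by omega))]; simp
    | succ i =>
      rw [h2, ih _ (fun m hm => hs (m + 1) (by omega))]
      simp

theorem seqExp_eq_pairExp {k d : ℕ} (p : SeqPair k d) (s : ℕ → Fin k × Fin k)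
    (hs : ∀ t : Fin d, s (d - 1 - t) = (p.1 t, p.2 t)) : seqExp p = pairExp s d := by
  rw [seqExp, pairExp, ← Finset.sum_range_reflect, ← Fin.sum_univ_eq_sum_range]
  refine Finset.sum_congr rfl fun t _ => ?_
  rw [hs]

theorem weight_add_two_pow_smul {k : ℕ} (a b : Fin k →₀ ℕ) {r i : ℕ} (h : i < r) :
    weight (a + 2 ^ r • b) i = weight a i := by
  rw [weight_apply, weight_apply]
  congr 1
  ext j
  have h1 : ∀ x : ℕ, x.testBit i = (x % 2 ^ r).testBit i := by
    intro x; rw [Nat.testBit_mod_two_pow]; simp [h]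
  rw [Finset.mem_filter, Finset.mem_filter, h1 ((a + 2 ^ r • b) j), h1 (a j), Finsupp.add_apply,
    Finsupp.smul_apply, smul_eq_mul, Nat.add_mul_mod_self_left]

theorem partialDeg_add_two_pow_smul {k : ℕ} (a b : Fin k →₀ ℕ) {r h : ℕ} (hh : h ≤ r) :
    partialDeg h (a + 2 ^ r • b) = partialDeg h a := by
  rw [partialDeg, partialDeg]
  refine Finset.sum_congr rfl fun i hi => ?_
  rw [Finset.mem_range] at hi
  rw [weight_add_two_pow_smul _ _ (by omega)]

/-- A functional on hit polynomials vanishes on the three subspaces in the definition of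
compatibility, even after multiplication by a `2^d₀`-th power. -/
theorem IsK.mul_two_pow_eq_zero {k c D d₀ t : ℕ} {n : ℕ → ℕ} (hn : DegSeq c D n)
    (hk : k = c + 2) (hd₀ : 2 < d₀) {Z : Fn k} (hZ : IsK Z (n t)) (ht : t + d₀ ≤ D)
    (s : ℕ → Fin k × Fin k) (hs : ∀ m < d₀, (s m).1 ≠ (s m).2) (b : Fin k →₀ ℕ) {G : P k}
    (hG : G ∈ subHit k d₀ ⊔ PMinus k (weight (pairExp s d₀)) ⊔
      spikeSpace k (c * (2 ^ d₀ - 1))) : Z (G * mon b ^ 2 ^ d₀) = 0 := by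
  suffices h : subHit k d₀ ⊔ PMinus k (weight (pairExp s d₀)) ⊔ spikeSpace k (c * (2 ^ d₀ - 1)) ≤
      LinearMap.ker (Z.comp (LinearMap.mulRight (ZMod 2) (mon b ^ 2 ^ d₀))) by
    simpa using h hG
  refine sup_le (sup_le ?_ ?_) ?_
  · rw [subHit, Submodule.span_le]
    rintro _ ⟨θ, hθ, f, rfl⟩
    simp only [SetLike.mem_coe, LinearMap.mem_ker, LinearMap.comp_apply, LinearMap.mulRight_apply]
    induction hθ using NonUnitalAlgebra.adjoin_induction generalizing f with
    | mem T hT =>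
      obtain ⟨i, hi, hi2, rfl⟩ := hT
      -- Squares below 2^d₀ are linear over 2^d₀-th powers, so the product is still hit.
      rw [← Sq_mul_two_pow _ _ hi2]
      exact hZ.sq _ _ hi
    | add T U _ _ h1 h2 => rw [LinearMap.add_apply, add_mul, map_add, h1, h2, add_zero]
    | zero => simp
    | mul T U _ _ h1 _ => exact h1 (U f)
    | smul r T _ h1 => rw [LinearMap.smul_apply, smul_mul_assoc, map_smul, h1, smul_zero]
  · rw [PMinus, Submodule.span_le]
    rintro _ ⟨a, ⟨-, j, hj, hj2⟩, rfl⟩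
    simp only [SetLike.mem_coe, LinearMap.mem_ker, LinearMap.comp_apply, LinearMap.mulRight_apply]
    rw [weight_pairExp hk s d₀ hs] at hj2
    have hjd : j < d₀ := by
      by_contra hcon
      rw [if_neg hcon] at hj2
      omega
    rw [if_pos hjd] at hj2
    rw [mon_pow, mon_mul]
    refine hZ.eq_zero_of_weight hn j t (by omega) _ (fun i hi => ?_) ?_
    · rw [weight_add_two_pow_smul _ _ (by omega), hj i hi, weight_pairExp hk s d₀ hs,
        if_pos (by omega)]
    · rwa [weight_add_two_pow_smul _ _ hjd]
  · rw [spikeSpace, Submodule.span_le]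
    rintro _ ⟨a, ⟨ha, z, hz, hzd, h, -, hlt⟩, rfl⟩
    simp only [SetLike.mem_coe, LinearMap.mem_ker, LinearMap.comp_apply, LinearMap.mulRight_apply]
    obtain ⟨i, hi, h1, h2⟩ := exists_partialDeg_lt hk hd₀ ha hz hzd hlt
    rw [mon_pow, mon_mul]
    refine (eq_zero_of_partialDeg hn hk i t (by omega) _).1 Z hZ ?_ ?_
    · rwa [partialDeg_add_two_pow_smul _ _ hi]
    · rw [partialDeg_add_two_pow_smul _ _ hi]
      omega

/-! ### The order on monomials -/

/-- The order on monomials, as a map to a linear order. -/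
noncomputable def monKey {k : ℕ} (a : Fin k →₀ ℕ) : Lex (ℕ →₀ ℕ) ×ₗ Lex (Fin k →₀ ℕ) :=
  toLex (toLex (weight a), toLex a)

theorem monKey_lt_iff {k : ℕ} {a b : Fin k →₀ ℕ} : monKey a < monKey b ↔ MonLT a b := by
  rw [monKey, monKey, Prod.Lex.toLex_lt_toLex, MonLT]
  rfl

theorem monKey_injective {k : ℕ} : Function.Injective (monKey (k := k)) := by
  intro a b h
  simp only [monKey, EmbeddingLike.apply_eq_iff_eq, Prod.mk.injEq] at h
  exact h.2

theorem finite_degree_eq (k m : ℕ) : {a : Fin k →₀ ℕ | a.degree = m}.Finite := by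
  refine (Finset.finite_toSet (Finset.finsuppAntidiag Finset.univ m)).subset fun a ha => ?_
  simp only [Set.mem_ofPred_eq, Finsupp.degree_eq_sum] at ha
  simpa using ha

/-- Admissible monomials span modulo hit polynomials, in terms of functionals. -/
theorem Fn.eq_zero_of_admissible {k m : ℕ} {Y : Fn k} (hY : IsK Y m)
    (h : ∀ a ∈ admissibleMonomials k m, Y (mon a) = 0) (f : P k) : Y f = 0 := by
  refine Fn.ext_mon (fun a => ?_) f
  by_contra hne
  have hfin : {a : Fin k →₀ ℕ | a.degree = m ∧ Y (mon a) ≠ 0}.Finite :=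
    (finite_degree_eq k m).subset fun a ha => ha.1
  have hdeg : a.degree = m := by
    by_contra hd
    exact hne (hY.deg a hd)
  -- The least monomial with non-zero value would be inadmissible, although Y vanishes on everything
  -- below it.
  obtain ⟨b, ⟨hb, hbY⟩, hmin⟩ := Set.exists_min_image _ monKey hfin ⟨a, hdeg, hne⟩
  have hin : Inadmissible b := by
    by_contra hcon
    exact hbY (h b ⟨hb, hcon⟩)
  obtain ⟨S, hS, hhit⟩ := hin
  have hk : hit k ≤ LinearMap.ker Y := by
    refine iSup_le ?_
    rintro ⟨i, hi⟩ _ ⟨u, rfl⟩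
    exact hY.sq i u hi
  have h0 := hk hhit
  rw [LinearMap.mem_ker, map_add, map_sum, Finset.sum_eq_zero, add_zero] at h0
  · exact hbY h0
  · intro x hx
    by_contra hx0
    have h1 := hmin x ⟨(hS x hx).1.trans hb, hx0⟩
    exact absurd (monKey_lt_iff.2 (hS x hx).2) (not_lt.2 h1)

/-! ### Omitting two variables -/

/-- The injection of indices underlying `skip₂`. -/
def skipMap (k i j : ℕ) (u : Fin (k - 2)) : Fin k :=
  if (u : ℕ) < j - 1 then
    if (u : ℕ) < i then ⟨u, by omega⟩ else ⟨u + 1, by omega⟩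
  else
    if (u : ℕ) + 1 < i then ⟨u + 1, by omega⟩ else ⟨u + 2, by omega⟩

theorem skip₂_eq (k i j : ℕ) : skip₂ k i j = rename (skipMap k i j) := by
  apply MvPolynomial.algHom_ext
  intro u
  rw [skip₂, AlgHom.comp_apply, skip, skip, rename_X]
  erw [rename_X, rename_X]
  congr 1
  simp only [skipMap]
  split_ifs <;> simp_all

theorem skipMap_injective (k i j : ℕ) : Function.Injective (skipMap k i j) := by
  intro u v huv
  simp only [skipMap] at huv
  ext
  split_ifs at huv <;> simp only [Fin.mk.injEq] at huv <;> omega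

theorem mem_range_skipMap {k : ℕ} {i j : Fin k} (h : i < j) {l : Fin k} (hi : l ≠ i)
    (hj : l ≠ j) : l ∈ Set.range (skipMap k i j) := by
  have h1 : (l : ℕ) ≠ i := fun h => hi (Fin.ext h)
  have h2 : (l : ℕ) ≠ j := fun h => hj (Fin.ext h)
  have h3 : (i : ℕ) < j := h
  have h4 := j.2
  have h5 := l.2
  obtain h6 | ⟨h6, h7⟩ | h6 : (l : ℕ) < i ∨ ((i : ℕ) < l ∧ (l : ℕ) < j) ∨ (j : ℕ) < l := by omega
  · refine ⟨⟨l, by omega⟩, ?_⟩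
    simp only [skipMap]
    rw [if_pos (by omega), if_pos h6]
  · refine ⟨⟨l - 1, by omega⟩, ?_⟩
    simp only [skipMap]
    rw [if_pos (by omega), if_neg (by omega)]
    ext; simp; omega
  · refine ⟨⟨l - 2, by omega⟩, ?_⟩
    simp only [skipMap]
    rw [if_neg (by omega), if_neg (by omega)]
    ext; simp; omega

theorem IsK.comp_rename {k l m : ℕ} {Z : Fn k} (hZ : IsK Z m) (f : Fin l → Fin k) :
    IsK (Z.comp (rename f : P l →ₐ[ZMod 2] P k).toLinearMap) m := by
  refine ⟨fun i u hi => ?_, fun a ha => ?_⟩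
  · simp only [LinearMap.comp_apply, AlgHom.toLinearMap_apply]
    rw [← Sq_rename]
    exact hZ.sq i _ hi
  · simp only [LinearMap.comp_apply, AlgHom.toLinearMap_apply]
    rw [mon, rename_monomial]
    refine hZ.deg _ ?_
    rwa [Finsupp.degree_mapDomain]

/-! ### Stripping the low bits -/

/-- The functional `y ↦ Z (∏_{m < b} X_{s m}^{2^m} · y^{2^b})`. -/
noncomputable def Fn.strip {k : ℕ} (Z : Fn k) (s : ℕ → Fin k × Fin k) : ℕ → Fn k
  | 0 => Z
  | b + 1 => (Fn.strip Z s b).mulSq (mon (exceptExp k (s b).1 (s b).2))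

theorem Fn.strip_apply {k : ℕ} (Z : Fn k) (s : ℕ → Fin k × Fin k) (b : ℕ) (y : P k) :
    Z.strip s b y = Z (mon (pairExp s b) * y ^ 2 ^ b) := by
  induction b generalizing y with
  | zero => simp [Fn.strip, pairExp, mon_zero]
  | succ b ih =>
    rw [Fn.strip, Fn.mulSq_apply, ih, pairExp_succ, ← mon_mul, ← mon_pow, mul_pow, ← pow_mul,
      mul_assoc, pow_succ' 2 b]

theorem IsK.strip {k c D : ℕ} {n : ℕ → ℕ} (hn : DegSeq c D n) (hk : k = c + 2) {Z : Fn k}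
    (hZ : IsK Z (n 0)) {s : ℕ → Fin k × Fin k} (hs : ∀ m, (s m).1 < (s m).2) (b : ℕ)
    (hb : b ≤ D) : IsK (Z.strip s b) (n b) := by
  induction b with
  | zero => exact hZ
  | succ b ih =>
    rw [Fn.strip, mon_exceptExp]
    exact (ih (by omega)).mulSq_sqf hn hb (card_sdiff_pair hk (hs b).ne)

theorem pairExp_congr {k : ℕ} {s s' : ℕ → Fin k × Fin k} {n : ℕ} (h : ∀ m < n, s m = s' m) :
    pairExp s n = pairExp s' n :=
  Finset.sum_congr rfl fun m hm => by rw [h m (Finset.mem_range.1 hm)]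

theorem pairExp_add {k : ℕ} (s : ℕ → Fin k × Fin k) (m n : ℕ) :
    pairExp s (m + n) = pairExp s m + 2 ^ m • pairExp (fun i => s (m + i)) n := by
  rw [pairExp, Finset.sum_range_add, pairExp, pairExp, Finset.smul_sum]
  simp [pow_add, mul_smul]

/-- The value of `Z` at `∏_{m < D} X_{s m}^{2^m} · y^{2^D}`. -/
noncomputable def Fn.val {k : ℕ} (Z : Fn k) (D : ℕ) (s : ℕ → Fin k × Fin k)
    (y : Fin k →₀ ℕ) : ZMod 2 := Z (mon (pairExp s D) * mon y ^ 2 ^ D)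

theorem Fn.val_succ {k : ℕ} (Z : Fn k) (E : ℕ) (s : ℕ → Fin k × Fin k) (y : Fin k →₀ ℕ) :
    Z.val (E + 1) s y = Z.strip s E (mon (exceptExp k (s E).1 (s E).2) * mon y ^ 2) := by
  rw [Fn.val, ← Fn.strip_apply, Fn.strip, Fn.mulSq_apply]

/-- The bits above the window join y in a 2^d-th power, the shape required by
`IsK.mul_two_pow_eq_zero`. -/
theorem Fn.val_split {k : ℕ} (Z : Fn k) (b d e : ℕ) (s s' : ℕ → Fin k × Fin k) (y : Fin k →₀ ℕ)
    (h : ∀ m, m < b ∨ b + d ≤ m → s' m = s m) :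
    Z.val (b + d + e) s' y = Z.strip s b (mon (pairExp (fun m => s' (b + m)) d) *
      mon (pairExp (fun m => s (b + d + m)) e + 2 ^ e • y) ^ 2 ^ d) := by
  rw [Fn.val, Fn.strip_apply, pairExp_add, pairExp_add, pairExp_congr (fun m hm => h m (Or.inl hm)),
    pairExp_congr (s := fun i => s' (b + d + i)) (fun m _ => h (b + d + m) (Or.inr (by omega)))]
  simp only [mon_pow, mon_mul]
  congr 2
  simp only [smul_add, smul_smul, ← pow_add]
  rw [add_assoc b d e]
  abel

/-! ### Replacing a window -/

theorem seqMin_le {k d : ℕ} (I : Fin d → Fin k) (t : Fin d) : seqMin I ≤ I t :=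
  Nat.sInf_le ⟨t, rfl⟩

theorem seqMin_eq_of_monotone {k d : ℕ} {I : Fin d → Fin k} (h : Monotone I) (hd : 0 < d) :
    seqMin I = I ⟨0, hd⟩ := by
  refine le_antisymm (seqMin_le I _) (le_csInf ⟨_, ⟨0, hd⟩, rfl⟩ ?_)
  rintro _ ⟨t, rfl⟩
  exact h (Fin.mk_le_of_le_val (Nat.zero_le _))

/-- The only use of reduced lengths: the two highest bits of an inserted window carry the same pair.
-/
theorem eq_of_rl_le {k d : ℕ} {I : Fin d → Fin k} (hd : 2 ≤ d) (h : rl I ≤ d - 2) :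
    I ⟨1, by omega⟩ = I ⟨0, by omega⟩ := by
  obtain ⟨d, rfl⟩ : ∃ e, d = e + 2 := ⟨d - 2, by omega⟩
  by_contra hne
  have h1 : List.ofFn I = I 0 :: I 1 :: List.ofFn fun i : Fin d => I i.succ.succ := by
    simp [List.ofFn_succ]
  have hne' : (I 1 == I 0) = false := by
    rw [beq_eq_false_iff_ne]; exact hne
  rw [rl, h1] at h
  simp only [List.dropWhile_cons, hne'] at h
  simp at h

/-- `s'` arises from `s` by putting an element of `B` in the bits `b, …, b + d₀ - 1`, so that the
least indices there do not increase. -/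
structure Replaces {k d₀ : ℕ} (B : Set (SeqPair k d₀)) (b : ℕ) (s s' : ℕ → Fin k × Fin k) :
    Prop where
  out : ∀ m, m < b ∨ b + d₀ ≤ m → s' m = s m
  mem : ∃ p ∈ B, ∀ t : Fin d₀, s' (b + (d₀ - 1 - t)) = (p.1 t, p.2 t)
  top : s' (b + (d₀ - 2)) = s' (b + (d₀ - 1))
  fst_le : ∀ m < d₀, (s' (b + (d₀ - 1))).1 ≤ (s (b + m)).1
  snd_le : ∀ m < d₀, (s' (b + (d₀ - 1))).2 ≤ (s (b + m)).2

section

variable {k c D d₀ : ℕ} {n : ℕ → ℕ} {B : Set (SeqPair k d₀)} {Z : Fn k}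

/-- Stripping the bits below b leaves a functional of the first kind in degree `n b`; compatibility
then applies to the window. -/
theorem Fn.val_eq_zero_of_replaces (hn : DegSeq c D n) (hk : k = c + 2) (hd₀ : 2 < d₀)
    (hB : B ⊆ PInc k d₀) (hcomp : Compatible k d₀ B) (hZ : IsK Z (n 0)) {b : ℕ}
    (hb : b + d₀ ≤ D) {s : ℕ → Fin k × Fin k} (hs : ∀ m, (s m).1 < (s m).2) {y : Fin k →₀ ℕ}
    (h : ∀ s', (∀ m, (s' m).1 < (s' m).2) → Replaces B b s s' → Z.val D s' y = 0) :
    Z.val D s y = 0 := by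
  obtain ⟨e, rfl⟩ : ∃ e, D = b + d₀ + e := ⟨D - (b + d₀), by omega⟩
  -- Sequences run from the highest bit down, whereas s counts bits from the lowest up.
  set q : SeqPair k d₀ := (fun t => (s (b + (d₀ - 1 - t))).1, fun t => (s (b + (d₀ - 1 - t))).2)
    with hq
  obtain ⟨Bu, hBu, hmem⟩ := hcomp.2 q (fun t => hs _)
  have hqe : seqExp q = pairExp (fun m => s (b + m)) d₀ := seqExp_eq_pairExp q _ fun t => rfl
  rw [show k - 2 = c by omega, hqe] at hmem
  have h0 := (hZ.strip hn hk hs b (by omega)).mul_two_pow_eq_zero hn hk hd₀ (by omega)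
    (fun m => s (b + m)) (fun m _ => (hs _).ne)
    (pairExp (fun m => s (b + d₀ + m)) e + 2 ^ e • y) hmem
  rw [add_mul, map_add, ← Fn.val_split Z b d₀ e s s y (fun _ _ => rfl), Finset.sum_mul, map_sum,
    Finset.sum_eq_zero, add_zero] at h0
  · exact h0
  intro u hu
  rw [Finset.mem_Icc] at hu
  rw [Finset.sum_mul, map_sum]
  refine Finset.sum_eq_zero fun p hp => ?_
  obtain ⟨hpB, hp1, hp2⟩ := hBu u p hp
  obtain ⟨hpS, hm1, hm2⟩ := hB hpB
  set s' : ℕ → Fin k × Fin k := fun m => if hm : b ≤ m ∧ m < b + d₀ then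
    (p.1 ⟨d₀ - 1 - (m - b), by omega⟩, p.2 ⟨d₀ - 1 - (m - b), by omega⟩) else s m with hs'
  have hout : ∀ m, m < b ∨ b + d₀ ≤ m → s' m = s m := by
    intro m hm
    simp only [hs']
    rw [dif_neg (by omega)]
  have hin : ∀ t : Fin d₀, s' (b + (d₀ - 1 - t)) = (p.1 t, p.2 t) := by
    intro t
    have := t.2
    simp only [hs']
    rw [dif_pos (by omega)]
    have e1 : (⟨d₀ - 1 - (b + (d₀ - 1 - t) - b), by omega⟩ : Fin d₀) = t := by
      ext; simp; omega
    rw [e1]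
  have htop := hin ⟨0, by omega⟩
  have htop1 := hin ⟨1, by omega⟩
  simp only [Nat.sub_zero] at htop
  simp only [Nat.sub_sub] at htop1
  -- A monotone sequence attains its minimum at the first term, which sits in the top bit of the
  -- window.
  have e1 := seqMin_eq_of_monotone hm1 (by omega)
  have e2 := seqMin_eq_of_monotone hm2 (by omega)
  rw [seqExp_eq_pairExp p (fun m => s' (b + m)) hin, ← Fn.val_split Z b d₀ e s s' y hout]
  refine h s' (fun m => ?_) ⟨hout, ⟨p, hpB, hin⟩, ?_, fun m hm => ?_, fun m hm => ?_⟩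
  · by_cases hm : b ≤ m ∧ m < b + d₀
    · simp only [hs', dif_pos hm]
      exact hpS _
    · simp only [hs', dif_neg hm]
      exact hs m
  · rw [htop]
    refine htop1.trans ?_
    rw [eq_of_rl_le (by omega) (hcomp.1 p hpB).1, eq_of_rl_le (by omega) (hcomp.1 p hpB).2]
  · have h3 := seqMin_le q.1 ⟨d₀ - 1 - m, by omega⟩
    rw [← hp1, e1] at h3
    simp only [hq] at h3
    rw [show d₀ - 1 - (d₀ - 1 - m) = m by omega] at h3
    rw [htop]
    exact h3
  · have h3 := seqMin_le q.2 ⟨d₀ - 1 - m, by omega⟩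
    have h4 := hu.2.trans h3
    rw [← hp2, e2] at h4
    simp only [hq] at h4
    rw [show d₀ - 1 - (d₀ - 1 - m) = m by omega] at h4
    rw [htop]
    exact h4

/-! ### Moving a variable out of the last factor -/

theorem Sq_one_sqf (S : Finset (Fin k)) :
    Sq k 1 (sqf S) = ∑ l ∈ S, sqf (S \ {l}) * X l ^ 2 := by
  induction S using Finset.induction with
  | empty =>
    have := (Sq_mon_of_lt (0 : Fin k →₀ ℕ)).1 1 (by simp)
    simpa [sqf, mon_zero] using this
  | insert i S hi ih =>
    have e : (sqf (insert i S) : P k) = X i * sqf S := Finset.prod_insert hi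
    rw [e, Sq_X_mul, Sq_zero, zero_add, ih, Finset.sum_insert hi, Finset.mul_sum, add_comm]
    congr 1
    · rw [Finset.insert_sdiff_of_mem _ (Finset.mem_singleton_self i),
        Finset.sdiff_eq_self_of_disjoint (Finset.disjoint_singleton_right.2 hi), mul_comm]
    · refine Finset.sum_congr rfl fun l hl => ?_
      have hli : i ∉ ({l} : Finset (Fin k)) := by
        rw [Finset.mem_singleton]; rintro rfl; exact hi hl
      rw [Finset.insert_sdiff_of_notMem _ hli, sqf, sqf, Finset.prod_insert, mul_assoc]
      rw [Finset.mem_sdiff]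
      exact fun h => hi h.1

/-- This is Z(Sq¹(x_S z²)) = 0: Sq¹ squares one variable of x_S at a time. -/
theorem IsK.sum_eq_zero {N : ℕ} (hZ : IsK Z N) (S : Finset (Fin k)) (z : P k) :
    ∑ l ∈ S, Z (sqf (S \ {l}) * (X l * z) ^ 2) = 0 := by
  rw [← hZ.sq 1 (sqf S * z ^ 2) (by norm_num), Sq_one_sq_mul, Sq_one_sqf, Finset.sum_mul, map_sum]
  refine Finset.sum_congr rfl fun l _ => ?_
  congr 1
  ring

theorem exceptExp_comm (a b : ℕ) : exceptExp k a b = exceptExp k b a := by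
  ext l
  simp [exceptExp, or_comm]

/-- The Sq¹ relation for all variables but x_b, at bit E: the factor x_a of y is traded for x_l, and
the pair {a, b} for {l, b}. -/
theorem Fn.val_eq_zero_of_move (hn : DegSeq c D n) (hk : k = c + 2) (hZ : IsK Z (n 0))
    {E : ℕ} (hE : E + 1 ≤ D) {s : ℕ → Fin k × Fin k} (hs : ∀ m, (s m).1 < (s m).2)
    {a b : Fin k} (hab : s E = (a, b) ∨ s E = (b, a)) (z : Fin k →₀ ℕ)
    (h : ∀ l, l ≠ a → l ≠ b →
      Z.val (E + 1) (Function.update s E (if l < b then (l, b) else (b, l)))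
        (Finsupp.single l 1 + z) = 0) :
    Z.val (E + 1) s (Finsupp.single a 1 + z) = 0 := by
  have hne : a ≠ b := by
    have := hs E
    rcases hab with h | h <;> rw [h] at this
    · exact this.ne
    · exact this.ne'
  have hsum := (hZ.strip hn hk hs E (by omega)).sum_eq_zero (Finset.univ \ {b}) (mon z)
  rw [Finset.sum_eq_single_of_mem a (by simpa using hne)] at hsum
  · rw [Fn.val_succ, mon_single_add, ← hsum]
    congr 2
    rw [sdiff_sdiff, Finset.sup_eq_union, ← Finset.insert_eq, ← mon_exceptExp]
    rcases hab with h | h <;> rw [h]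
    · rw [exceptExp_comm]
  · intro l hl hla
    have hlb : l ≠ b := by simpa using hl
    have h1 := h l hla hlb
    have h2 : ∀ w, Z.strip (Function.update s E w) E = Z.strip s E := by
      intro w
      ext1
      apply LinearMap.ext
      intro y
      rw [LinearMap.comp_apply, LinearMap.comp_apply, Fn.strip_apply, Fn.strip_apply,
        pairExp_congr (s := Function.update s E w) (s' := s)]
      intro m hm
      rw [Function.update_of_ne hm.ne]
    rw [Fn.val_succ, h2, Function.update_self, mon_single_add] at h1
    rw [← h1]
    congr 2
    rw [sdiff_sdiff, Finset.sup_eq_union, ← Finset.insert_eq, ← mon_exceptExp]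
    split_ifs
    · rw [exceptExp_comm]
    · rfl

end

/-! ### Reduction to the generating set -/

theorem pairExp_const {k : ℕ} (w : Fin k × Fin k) (e : ℕ) :
    pairExp (fun _ => w) e = (2 ^ e - 1) • exceptExp k w.1 w.2 := by
  rw [pairExp, ← Finset.sum_smul, Nat.geomSum_eq le_rfl]
  simp

section

variable {k c D d₀ : ℕ} {n : ℕ → ℕ} {B : Set (SeqPair k d₀)} {Z : Fn k}

/-- As y avoids x_i and x_j, it comes from P_{k-2}. The stripped functional restricts there to one
that kills hit polynomials, so testing admissible monomials suffices. -/
theorem Fn.val_eq_zero_of_genSet (hn : DegSeq c D n) (hk : k = c + 2) (hd₀ : 2 < d₀)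
    (hD : d₀ ≤ D) (hB : B ⊆ PInc k d₀) (hZ : IsK Z (n 0))
    (hgen : ∀ g ∈ genSet k d₀ D (n D) B, Z g = 0) {s : ℕ → Fin k × Fin k}
    (hs : ∀ m, (s m).1 < (s m).2) {i j : Fin k} {p : SeqPair k d₀} (hp : p ∈ B)
    (hps : ∀ t : Fin d₀, s (d₀ - 1 - t) = (p.1 t, p.2 t))
    (hij : ∀ m, d₀ - 1 ≤ m → m < D → s m = (i, j)) {y : Fin k →₀ ℕ} (hyi : y i = 0)
    (hyj : y j = 0) : Z.val D s y = 0 := by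
  obtain ⟨e, rfl⟩ : ∃ e, D = d₀ + e := ⟨D - d₀, by omega⟩
  obtain ⟨-, hm1, hm2⟩ := hB hp
  have htop := hij (d₀ - 1) le_rfl (by omega)
  have hlt : i < j := by have := hs (d₀ - 1); rwa [htop] at this
  have hp0 := hps ⟨0, by omega⟩
  simp only [Nat.sub_zero] at hp0
  rw [htop, Prod.mk.injEq] at hp0
  have e1 : seqMin p.1 = i := by rw [seqMin_eq_of_monotone hm1 (by omega), ← hp0.1]
  have e2 : seqMin p.2 = j := by rw [seqMin_eq_of_monotone hm2 (by omega), ← hp0.2]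
  have hvars : (((mon y : P k).vars : Finset (Fin k)) : Set (Fin k)) ⊆
      Set.range (skipMap k i j) := by
    intro l hl
    rw [Finset.mem_coe, mon, vars_monomial one_ne_zero, Finsupp.mem_support_iff] at hl
    exact mem_range_skipMap hlt (by rintro rfl; exact hl hyi) (by rintro rfl; exact hl hyj)
  obtain ⟨q, hq⟩ := exists_rename_eq_of_vars_subset_range (mon y : P k) (skipMap k i j)
    (skipMap_injective k i j) hvars
  rw [Fn.val, ← Fn.strip_apply, ← hq]
  refine Fn.eq_zero_of_admissible ((hZ.strip hn hk hs (d₀ + e) le_rfl).comp_rename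
    (skipMap k i j)) (fun a ha => ?_) q
  refine (Fn.strip_apply _ _ _ _).trans (hgen _ ⟨p, hp, a, ha, ?_⟩)
  rw [AlgHom.toLinearMap_apply, ← skip₂_eq, e1, e2]
  congr 1
  rw [pairExp_add, pairExp_congr (s := fun m => s (d₀ + m)) (s' := fun _ => (i, j))
    (fun m hm => hij _ (by omega) (by omega)), pairExp_const, ← seqExp_eq_pairExp p s hps,
    mon_pow, mon_mul, smul_smul, Nat.mul_sub, mul_one, ← pow_add]

/-- Windows sliding down (`hR`) bring i and j into the lowest window, whose top bit becomes (i, j);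
sliding up (`hU`) carries this pair to bit D - 1; sliding down again (`hT`) fills every bit from d₀
- 2 on. Any strict drop of an index falls under `h1` or `h2`. -/
theorem Fn.val_eq_zero_of_phases (hn : DegSeq c D n) (hk : k = c + 2) (hd₀ : 2 < d₀)
    (hD : d₀ ≤ D) (hB : B ⊆ PInc k d₀) (hcomp : Compatible k d₀ B) (hZ : IsK Z (n 0))
    {i j : Fin k} {y : Fin k →₀ ℕ}
    (h1 : ∀ s : ℕ → Fin k × Fin k, (∀ m, (s m).1 < (s m).2) →
      (∃ m < D, (s m).1 < i) → Z.val D s y = 0)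
    (h2 : ∀ s : ℕ → Fin k × Fin k, (∀ m, (s m).1 < (s m).2) →
      (∃ m < D, (s m).1 = i) → (∃ m < D, (s m).2 < j) → Z.val D s y = 0)
    (hfin : ∀ s : ℕ → Fin k × Fin k, (∀ m, (s m).1 < (s m).2) →
      (∃ p ∈ B, ∀ t : Fin d₀, s (d₀ - 1 - t) = (p.1 t, p.2 t)) →
      (∀ m, d₀ - 2 ≤ m → m < D → s m = (i, j)) → Z.val D s y = 0)
    (s : ℕ → Fin k × Fin k) (hs : ∀ m, (s m).1 < (s m).2) (hi : ∃ m < D, (s m).1 = i)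
    (hj : ∃ m < D, (s m).2 = j) : Z.val D s y = 0 := by
  have hwin : ∀ b, b + d₀ ≤ D → ∀ s : ℕ → Fin k × Fin k, (∀ m, (s m).1 < (s m).2) →
      (∀ s', (∀ m, (s' m).1 < (s' m).2) → Replaces B b s s' → Z.val D s' y = 0) →
      Z.val D s y = 0 := fun b hb s hs h =>
    Fn.val_eq_zero_of_replaces hn hk hd₀ hB hcomp hZ hb hs h
  have hcmp : ∀ s : ℕ → Fin k × Fin k, (∀ m, (s m).1 < (s m).2) → ∀ x < D, (s x).1 ≤ i →
      (s x).2 ≤ j → (s x = (i, j) → Z.val D s y = 0) → Z.val D s y = 0 := by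
    intro s hs x hx hxi hxj h
    rcases hxi.lt_or_eq with hlt | heq
    · exact h1 s hs ⟨x, hx, hlt⟩
    · rcases hxj.lt_or_eq with hlt | heq'
      · exact h2 s hs ⟨x, hx, heq⟩ ⟨x, hx, hlt⟩
      · exact h (Prod.ext heq heq')
  -- The window has its top at the lowest bit of the constant block; as its two top bits agree, the
  -- block grows by one bit.
  have hT : ∀ m, d₀ - 1 ≤ m → m < D → ∀ s : ℕ → Fin k × Fin k, (∀ m, (s m).1 < (s m).2) →
      (∀ x, m ≤ x → x < D → s x = (i, j)) → Z.val D s y = 0 := by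
    intro m hm
    induction m, hm using Nat.le_induction with
    | base =>
      intro hlt s hs hx
      refine hwin 0 (by omega) s hs fun s' hs' hr => ?_
      have hout := hr.out
      have htop := hr.top
      have hf := hr.fst_le (d₀ - 1) (by omega)
      have hsn := hr.snd_le (d₀ - 1) (by omega)
      have hmem := hr.mem
      simp only [zero_add] at hout htop hf hsn hmem
      rw [hx (d₀ - 1) le_rfl hlt] at hf hsn
      refine hcmp s' hs' (d₀ - 1) hlt hf hsn fun he => hfin s' hs' hmem fun x hx1 hx2 => ?_
      obtain rfl | rfl | h : x = d₀ - 2 ∨ x = d₀ - 1 ∨ d₀ ≤ x := by omega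
      · rw [htop, he]
      · exact he
      · rw [hout x (Or.inr h), hx x (by omega) hx2]
    | succ m hm ih =>
      intro hlt s hs hx
      refine hwin (m + 2 - d₀) (by omega) s hs fun s' hs' hr => ?_
      have hout := hr.out
      have htop := hr.top
      have hf := hr.fst_le (d₀ - 1) (by omega)
      have hsn := hr.snd_le (d₀ - 1) (by omega)
      rw [show m + 2 - d₀ + (d₀ - 1) = m + 1 by omega] at htop hf hsn
      rw [show m + 2 - d₀ + (d₀ - 2) = m by omega] at htop
      rw [hx (m + 1) le_rfl hlt] at hf hsn
      refine hcmp s' hs' (m + 1) hlt hf hsn fun he => ih (by omega) s' hs' fun x hx1 hx2 => ?_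
      obtain rfl | rfl | h : x = m ∨ x = m + 1 ∨ m + 2 ≤ x := by omega
      · rw [htop, he]
      · exact he
      · rw [hout x (Or.inr (by omega)), hx x (by omega) hx2]
  -- Bit b is the second highest of the window, so the new pair at bit b + 1 is at most (i, j) in
  -- each index.
  have hU : ∀ e b, b + e + 1 = D → d₀ - 1 ≤ b → ∀ s : ℕ → Fin k × Fin k,
      (∀ m, (s m).1 < (s m).2) → s b = (i, j) → Z.val D s y = 0 := by
    intro e
    induction e with
    | zero =>
      intro b hb hb2 s hs he
      refine hT b hb2 (by omega) s hs fun x hx1 hx2 => ?_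
      rw [show x = b by omega, he]
    | succ e ih =>
      intro b hb hb2 s hs he
      refine hwin (b + 2 - d₀) (by omega) s hs fun s' hs' hr => ?_
      have hf := hr.fst_le (d₀ - 2) (by omega)
      have hsn := hr.snd_le (d₀ - 2) (by omega)
      rw [show b + 2 - d₀ + (d₀ - 1) = b + 1 by omega,
        show b + 2 - d₀ + (d₀ - 2) = b by omega, he] at hf hsn
      exact hcmp s' hs' (b + 1) (by omega) hf hsn fun he' =>
        ih (b + 1) (by omega) (by omega) s' hs' he'
  -- The indices i and j may occur in different bits. The repeated top pair puts the least indices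
  -- also one bit lower, within reach of the next window.
  have hR : ∀ b, b + d₀ ≤ D → ∀ s : ℕ → Fin k × Fin k, (∀ m, (s m).1 < (s m).2) →
      (∃ m < b + d₀, (s m).1 = i) → (∃ m < b + d₀, (s m).2 = j) → Z.val D s y = 0 := by
    intro b
    induction b with
    | zero =>
      rintro hb s hs ⟨m, hm, hmi⟩ ⟨m', hm', hmj⟩
      refine hwin 0 hb s hs fun s' hs' hr => ?_
      have hf := hr.fst_le m (by omega)
      have hsn := hr.snd_le m' (by omega)
      simp only [zero_add] at hf hsn
      rw [hmi] at hf
      rw [hmj] at hsn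
      exact hcmp s' hs' (d₀ - 1) (by omega) hf hsn fun he =>
        hU (D - d₀) (d₀ - 1) (by omega) le_rfl s' hs' he
    | succ b ih =>
      rintro hb s hs ⟨m, hm, hmi⟩ ⟨m', hm', hmj⟩
      refine hwin (b + 1) hb s hs fun s' hs' hr => ?_
      have htop := hr.top
      rw [show b + 1 + (d₀ - 1) = b + d₀ by omega,
        show b + 1 + (d₀ - 2) = b + d₀ - 1 by omega] at htop
      have hi' : (∃ x < b + d₀, (s' x).1 = i) ∨ Z.val D s' y = 0 := by
        by_cases h : m < b + 1
        · exact Or.inl ⟨m, by omega, by rw [hr.out m (Or.inl h), hmi]⟩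
        · have hf := hr.fst_le (m - (b + 1)) (by omega)
          rw [show b + 1 + (d₀ - 1) = b + d₀ by omega,
            show b + 1 + (m - (b + 1)) = m by omega, hmi] at hf
          rcases hf.lt_or_eq with hlt | heq
          · exact Or.inr (h1 s' hs' ⟨b + d₀, by omega, hlt⟩)
          · exact Or.inl ⟨b + d₀ - 1, by omega, by rw [htop, heq]⟩
      rcases hi' with ⟨x, hx, hxi⟩ | h0
      · by_cases h : m' < b + 1
        · exact ih (by omega) s' hs' ⟨x, hx, hxi⟩
            ⟨m', by omega, by rw [hr.out m' (Or.inl h), hmj]⟩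
        · have hf := hr.snd_le (m' - (b + 1)) (by omega)
          rw [show b + 1 + (d₀ - 1) = b + d₀ by omega,
            show b + 1 + (m' - (b + 1)) = m' by omega, hmj] at hf
          rcases hf.lt_or_eq with hlt | heq
          · exact h2 s' hs' ⟨x, by omega, hxi⟩ ⟨b + d₀, by omega, hlt⟩
          · exact ih (by omega) s' hs' ⟨x, hx, hxi⟩ ⟨b + d₀ - 1, by omega, by rw [htop, heq]⟩
      · exact h0
  refine hR (D - d₀) (by omega) s hs ?_ ?_
  · rwa [Nat.sub_add_cancel hD]
  · rwa [Nat.sub_add_cancel hD]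

/-- If `Z` vanishes on the generating set, it vanishes on all `∏_{m < D} X_{s m}^{2^m} · y^{2^D}`. -/
theorem Fn.val_eq_zero (hn : DegSeq c D n) (hk : k = c + 2) (hd₀ : 2 < d₀)
    (hD : d₀ ≤ D) (hB : B ⊆ PInc k d₀) (hcomp : Compatible k d₀ B) (hZ : IsK Z (n 0))
    (hgen : ∀ g ∈ genSet k d₀ D (n D) B, Z g = 0) (s : ℕ → Fin k × Fin k)
    (hs : ∀ m, (s m).1 < (s m).2) (y : Fin k →₀ ℕ) : Z.val D s y = 0 := by
  -- For a fixed pair (i, j), induction on the exponents of x_i and x_j in y; smaller i, and equal i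
  -- with smaller j, are assumed known.
  have hT3 : ∀ i j : Fin k,
      (∀ (s : ℕ → Fin k × Fin k) (y : Fin k →₀ ℕ), (∀ m, (s m).1 < (s m).2) →
        (∃ m < D, (s m).1 < i) → Z.val D s y = 0) →
      (∀ (s : ℕ → Fin k × Fin k) (y : Fin k →₀ ℕ), (∀ m, (s m).1 < (s m).2) →
        (∃ m < D, (s m).1 = i) → (∃ m < D, (s m).2 < j) → Z.val D s y = 0) →
      ∀ N (y : Fin k →₀ ℕ), y i + y j = N → ∀ s : ℕ → Fin k × Fin k, (∀ m, (s m).1 < (s m).2) →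
        (∃ m < D, (s m).1 = i) → (∃ m < D, (s m).2 = j) → Z.val D s y = 0 := by
    intro i j h1 h2 N
    induction N using Nat.strong_induction_on with
    | _ N ih =>
      intro y hy
      refine Fn.val_eq_zero_of_phases hn hk hd₀ hD hB hcomp hZ (fun s hs => h1 s y hs)
        (fun s hs => h2 s y hs) fun s hs hp hij => ?_
      obtain ⟨E, rfl⟩ : ∃ E, D = E + 1 + 1 := ⟨D - 2, by omega⟩
      have hE := hij E (by omega) (by omega)
      have hE1 := hij (E + 1) (by omega) (by omega)
      have hlt : i < j := by have := hs E; rwa [hE] at this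
      have hmove : ∀ a b : Fin k, ((a, b) = (i, j) ∨ (b, a) = (i, j)) → y a ≠ 0 →
          Z.val (E + 1 + 1) s y = 0 := by
        intro a b hab hya
        obtain ⟨z, rfl⟩ : ∃ z, y = Finsupp.single a 1 + z := by
          refine ⟨y - Finsupp.single a 1, ?_⟩
          rw [add_tsub_cancel_of_le]
          rw [Finsupp.single_le_iff]
          omega
        refine Fn.val_eq_zero_of_move hn hk hZ (by omega) hs (b := b) ?_ z fun l hla hlb => ?_
        · rw [hE1]
          exact hab.imp Eq.symm Eq.symm
        -- Bit E still carries (i, j), so neither index is lost when bit E + 1 changes. If D = d₀,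
        -- this is bit d₀ - 2, which is why the block had to reach it.
        · have hE' : Function.update s (E + 1) (if l < b then (l, b) else (b, l)) E = (i, j) := by
            rw [Function.update_of_ne (by omega), hE]
          refine ih _ ?_ _ rfl _ (fun m => ?_) ⟨E, by omega, by rw [hE']⟩
            ⟨E, by omega, by rw [hE']⟩
          · rw [← hy]
            have hne : i ≠ j := hlt.ne
            rcases hab with h | h <;> rw [Prod.mk.injEq] at h <;> obtain ⟨rfl, rfl⟩ := h <;>
              simp only [Finsupp.add_apply, Finsupp.single_apply, if_neg hla, if_neg hlb,
                if_neg hne, if_neg hne.symm, if_true] <;> omega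
          · rcases eq_or_ne m (E + 1) with rfl | hm
            · rw [Function.update_self]
              split_ifs with h
              · exact h
              · exact lt_of_le_of_ne (not_lt.1 h) (Ne.symm hlb)
            · rw [Function.update_of_ne hm]
              exact hs m
      by_cases hyi : y i = 0
      · by_cases hyj : y j = 0
        · obtain ⟨p, hpB, hp⟩ := hp
          exact Fn.val_eq_zero_of_genSet hn hk hd₀ hD hB hZ hgen hs hpB hp
            (fun m hm => hij m (by omega)) hyi hyj
        · exact hmove j i (Or.inr rfl) hyj
      · exact hmove i j (Or.inl rfl) hyi
  have hT1 : ∀ iv : ℕ, ∀ (s : ℕ → Fin k × Fin k) (y : Fin k →₀ ℕ), (∀ m, (s m).1 < (s m).2) →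
      (∃ m < D, ((s m).1 : ℕ) < iv) → Z.val D s y = 0 := by
    intro iv
    induction iv with
    | zero => rintro s y hs ⟨m, -, hm⟩; omega
    | succ iv ih1 =>
      have hT2 : ∀ jv : ℕ, ∀ (s : ℕ → Fin k × Fin k) (y : Fin k →₀ ℕ),
          (∀ m, (s m).1 < (s m).2) → (∃ m < D, ((s m).1 : ℕ) = iv) →
          (∃ m < D, ((s m).2 : ℕ) < jv) → Z.val D s y = 0 := by
        intro jv
        induction jv with
        | zero => rintro s y hs - ⟨m, -, hm⟩; omega
        | succ jv ih2 =>
          rintro s y hs ⟨m, hm, hmi⟩ ⟨m', hm', hmj⟩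
          by_cases h : ((s m').2 : ℕ) < jv
          · exact ih2 s y hs ⟨m, hm, hmi⟩ ⟨m', hm', h⟩
          · have hmj' : ((s m').2 : ℕ) = jv := by omega
            refine hT3 (s m).1 (s m').2 ?_ ?_ _ y rfl s hs ⟨m, hm, rfl⟩ ⟨m', hm', rfl⟩
            · rintro s₁ y₁ hs₁ ⟨x, hx, hx2⟩
              refine ih1 s₁ y₁ hs₁ ⟨x, hx, ?_⟩
              rw [← hmi]; exact hx2
            · rintro s₁ y₁ hs₁ ⟨x, hx, hx2⟩ ⟨x', hx', hx2'⟩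
              refine ih2 s₁ y₁ hs₁ ⟨x, hx, by rw [hx2, hmi]⟩ ⟨x', hx', ?_⟩
              rw [← hmj']; exact hx2'
      rintro s y hs ⟨m, hm, hmi⟩
      by_cases h : ((s m).1 : ℕ) < iv
      · exact ih1 s y hs ⟨m, hm, h⟩
      · exact hT2 k s y hs ⟨m, hm, by omega⟩ ⟨m, hm, (s m).2.2⟩
  exact hT1 k s y hs ⟨0, by omega, (s 0).1.2⟩

end

/-! ### Kameko's operation -/

section

variable {k c D d₀ : ℕ} {n : ℕ → ℕ} {B : Set (SeqPair k d₀)} {Z : Fn k}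

theorem exists_eq_sdiff_pair (hk : k = c + 2) {S : Finset (Fin k)} (hS : S.card = c) :
    ∃ a b, a ≠ b ∧ S = Finset.univ \ {a, b} := by
  have h2 : (Finset.univ \ S).card = 2 := by
    rw [Finset.card_sdiff_of_subset (Finset.subset_univ _)]; simp; omega
  obtain ⟨a, b, hab, h⟩ := Finset.card_eq_two.1 h2
  refine ⟨a, b, hab, ?_⟩
  rw [← h, sdiff_sdiff_right_self]; simp

theorem X_mul_sqf {S : Finset (Fin k)} {a : Fin k} (ha : a ∈ S) :
    (X a * sqf (S \ {a}) : P k) = sqf S := by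
  rw [sqf, sqf, Finset.sdiff_singleton_eq_erase]
  exact Finset.mul_prod_erase S _ ha

/-- For l ≠ a the product of x_l and all variables but x_a is X_{a,l} x_l². The Sq¹ relation thus
trades a full second bit for consecutive factors X_{b,l} and X_{a,l}. -/
theorem IsK.mulSq_pair_univ_eq_zero {N : ℕ} (hZ : IsK Z N) {a b : Fin k} (hab : a ≠ b)
    (h : ∀ l, l ≠ a → l ≠ b →
      (Z.mulSq (sqf (Finset.univ \ {b, l}))).mulSq (sqf (Finset.univ \ {a, l})) = 0) (w : P k) :
    Z.mulSq (sqf (Finset.univ \ {a, b})) (sqf Finset.univ * w ^ 2) = 0 := by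
  have hsd : ∀ a l : Fin k, (Finset.univ \ {a}) \ {l} = Finset.univ \ {a, l} := by
    intro a l
    rw [sdiff_sdiff, Finset.sup_eq_union, ← Finset.insert_eq]
  have hsum := hZ.sum_eq_zero (Finset.univ \ {b}) (sqf (Finset.univ \ {a}) * w ^ 2)
  rw [Finset.sum_eq_single_of_mem a (by simpa using hab)] at hsum
  · rwa [hsd, Finset.pair_comm, ← mul_assoc, X_mul_sqf (Finset.mem_univ a)] at hsum
  · intro l hl hla
    have hlb : l ≠ b := by simpa using hl
    have h4 := LinearMap.congr_fun (h l hla hlb) (X l * w)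
    rw [Fn.mulSq_apply, Fn.mulSq_apply, LinearMap.zero_apply] at h4
    have e1 : X l * (sqf (Finset.univ \ {a}) * w ^ 2) =
        sqf (Finset.univ \ {a, l}) * (X l * w) ^ 2 := by
      rw [← X_mul_sqf (S := Finset.univ \ {a}) (a := l) (by simpa using hla), hsd]
      ring
    rw [e1, hsd, h4]

/-- Induction on the number of bits. After X_{a,b} the next square-free factor has fewer than c
variables (zero), c (induction), or all k, where the Sq¹ trade brings back the case of c. -/
theorem IsK.mulSq_pair_eq_zero (hn : DegSeq c D n) (hk : k = c + 2) (e t : ℕ) (ht : t + e = D)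
    {Z : Fn k} (hZ : IsK Z (n t))
    (h : ∀ s : ℕ → Fin k × Fin k, (∀ m, (s m).1 < (s m).2) → ∀ y, Z.val e s y = 0) :
    (e = 0 → Z = 0) ∧ (0 < e → ∀ a b, a ≠ b → Z.mulSq (sqf (Finset.univ \ {a, b})) = 0) := by
  induction e generalizing t Z with
  | zero =>
    refine ⟨fun _ => ?_, fun h0 => absurd h0 (lt_irrefl 0)⟩
    let s : ℕ → Fin k × Fin k := fun _ => (⟨0, by omega⟩, ⟨1, by omega⟩)
    refine lin_ext fun y => ?_
    have := h s (fun m => by simp [s, Fin.lt_def]) y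
    simpa [Fn.val, pairExp, mon_zero] using this
  | succ e ih =>
    refine ⟨fun h0 => absurd h0 (Nat.succ_ne_zero e), fun _ => ?_⟩
    have hlt : ∀ a b : Fin k, a < b →
        (e = 0 → Z.mulSq (sqf (Finset.univ \ {a, b})) = 0) ∧
        (0 < e → ∀ a' b', a' ≠ b' → (Z.mulSq (sqf (Finset.univ \ {a, b}))).mulSq
          (sqf (Finset.univ \ {a', b'})) = 0) := by
      intro a b hab
      refine ih (t + 1) (by omega)
        (hZ.mulSq_sqf hn (by omega) (card_sdiff_pair hk hab.ne)) fun s hs y => ?_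
      let s' : ℕ → Fin k × Fin k := fun m => Nat.casesOn m (a, b) s
      have hs' : ∀ m, (s' m).1 < (s' m).2 := by
        intro m
        cases m with
        | zero => exact hab
        | succ m => exact hs m
      have := h s' hs' y
      rw [Fn.val, pairExp_succ', ← mon_mul, ← mon_pow, mon_exceptExp, pow_succ 2 e, pow_mul,
        mul_assoc, ← mul_pow] at this
      exact this
    have hne : ∀ a b : Fin k, a ≠ b →
        (e = 0 → Z.mulSq (sqf (Finset.univ \ {a, b})) = 0) ∧
        (0 < e → ∀ a' b', a' ≠ b' → (Z.mulSq (sqf (Finset.univ \ {a, b}))).mulSq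
          (sqf (Finset.univ \ {a', b'})) = 0) := by
      intro a b hab
      rcases hab.lt_or_gt with h1 | h1
      · exact hlt a b h1
      · rw [Finset.pair_comm]; exact hlt b a h1
    intro a b hab
    rcases Nat.eq_zero_or_pos e with rfl | he
    · exact (hne a b hab).1 rfl
    · have hab' := hZ.mulSq_sqf hn (by omega) (card_sdiff_pair hk hab)
      refine lin_ext fun x => ?_
      obtain ⟨S, w, hx, -, -⟩ := exists_sqf_mul_sq x
      rw [hx, LinearMap.zero_apply]
      by_cases hdeg : S.card + 2 * w.degree = n (t + 1)
      · have hst := hn.step (t + 1) (by omega)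
        have hSk : S.card ≤ k := by simpa using Finset.card_le_univ S
        obtain h1 | h1 | h1 : S.card < c ∨ S.card = c ∨ S.card = k := by omega
        · rw [← Fn.mulSq_apply, hab'.mulSq_sqf_eq_zero hn (by omega) h1]; rfl
        · obtain ⟨a', b', hab2, rfl⟩ := exists_eq_sdiff_pair hk h1
          rw [← Fn.mulSq_apply, (hne a b hab).2 he a' b' hab2]; rfl
        · have hS : S = Finset.univ := by
            rw [← Finset.card_eq_iff_eq_univ, Fintype.card_fin]; omega
          subst hS
          exact hZ.mulSq_pair_univ_eq_zero hab
            (fun l hla hlb => (hne b l hlb.symm).2 he a l hla.symm) _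
      · exact hab'.sqf_mul_sq hdeg

/-- Once Z kills all X_{a,b} y², the functional α on full square-free parts kills hit polynomials.
Only monomials with all exponents odd can have non-zero value, so Z = α ∘ φ. -/
theorem IsK.eq_zero_of_phi_mem_hit (hn : DegSeq c D n) (hk : k = c + 2) (hD : 0 < D)
    (hZ : IsK Z (n 0))
    (h : ∀ s : ℕ → Fin k × Fin k, (∀ m, (s m).1 < (s m).2) → ∀ y, Z.val D s y = 0)
    {f : P k} (hf : phi k f ∈ hit k) : Z f = 0 := by
  have hpair := (hZ.mulSq_pair_eq_zero hn hk D 0 (zero_add D) h).2 hD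
  set α := Z.mulSq (sqf Finset.univ) with hα
  have hαhit : hit k ≤ LinearMap.ker α := by
    refine iSup_le ?_
    rintro ⟨i, hi⟩ _ ⟨u, rfl⟩
    obtain ⟨i, rfl⟩ : ∃ j, i = j + 1 := ⟨i - 1, by omega⟩
    rw [LinearMap.mem_ker, hα, hZ.mulSq_univ_Sq hn hk (by omega)]
    refine Finset.sum_eq_zero fun T hT => ?_
    obtain ⟨a, b, hab, rfl⟩ := Finset.card_eq_two.1 (Finset.mem_powersetCard.1 hT).2
    rw [hpair a b hab]; rfl
  have hZα : Z = α.comp (phi k) := by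
    refine lin_ext fun x => ?_
    obtain ⟨S, w, hx, -, -⟩ := exists_sqf_mul_sq x
    rw [hx, LinearMap.comp_apply, phi_mul_sq, sqf, phi_prod]
    by_cases hS : S = Finset.univ
    · subst hS
      rw [if_pos rfl, one_mul, hα, Fn.mulSq_apply, sqf]
    · rw [if_neg hS, zero_mul, map_zero]
      change Z (sqf S * mon w ^ 2) = 0
      by_cases hdeg : S.card + 2 * w.degree = n 0
      · have hst := hn.step 0 (by omega)
        have hSk : S.card < k := by
          simpa using Finset.card_lt_univ_of_notMem (s := S)
            (Classical.choose_spec (by simpa [Finset.eq_univ_iff_forall] using hS : ∃ x, x ∉ S))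
        obtain h1 | h1 : S.card < c ∨ S.card = c := by omega
        · rw [← Fn.mulSq_apply, hZ.mulSq_sqf_eq_zero hn (by omega) h1]; rfl
        · obtain ⟨a', b', hab2, rfl⟩ := exists_eq_sdiff_pair hk h1
          rw [← Fn.mulSq_apply, hpair a' b' hab2]; rfl
      · exact hZ.sqf_mul_sq hdeg
  rw [hZα]
  exact hαhit hf

/-! ### Degree of the generators and their image under `phi`. -/

theorem DegSeq.zero_eq (hn : DegSeq c D n) (b : ℕ) (hb : b ≤ D) :
    n 0 = c * (2 ^ b - 1) + 2 ^ b * n b := by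
  induction b with
  | zero => simp
  | succ b ih =>
    rw [ih (by omega), hn.step b hb, mul_two_pow_succ_sub_one]
    obtain ⟨r, hr⟩ : ∃ r, 2 ^ b = r + 1 :=
      ⟨2 ^ b - 1, by have := Nat.one_le_two_pow (n := b); omega⟩
    rw [pow_succ, hr, Nat.add_sub_cancel]
    ring

theorem degree_pairExp (hk : k = c + 2) (s : ℕ → Fin k × Fin k) (hs : ∀ m, (s m).1 < (s m).2)
    (b : ℕ) : (pairExp s b).degree = c * (2 ^ b - 1) := by
  induction b with
  | zero => simp [pairExp]
  | succ b ih =>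
    rw [pairExp_succ, map_add, ih, map_nsmul, exceptExp_eq, degree_indicator_one,
      card_sdiff_pair hk (hs b).ne, mul_two_pow_succ_sub_one, smul_eq_mul]
    obtain ⟨r, hr⟩ : ∃ r, 2 ^ b = r + 1 :=
      ⟨2 ^ b - 1, by have := Nat.one_le_two_pow (n := b); omega⟩
    rw [hr, Nat.add_sub_cancel]
    ring

theorem exists_of_mem_genSet (hd₀ : 2 < d₀) (hD : d₀ ≤ D) (hB : B ⊆ PInc k d₀) {m : ℕ} {g : P k}
    (hg : g ∈ genSet k d₀ D m B) : ∃ (s : ℕ → Fin k × Fin k) (y : Fin k →₀ ℕ),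
      (∀ m, (s m).1 < (s m).2) ∧ y.degree = m ∧ g = mon (pairExp s D) * mon y ^ 2 ^ D := by
  obtain ⟨p, hp, y, hy, rfl⟩ := hg
  obtain ⟨e, rfl⟩ : ∃ e, D = d₀ + e := ⟨D - d₀, by omega⟩
  obtain ⟨hpS, hm1, hm2⟩ := hB hp
  let s : ℕ → Fin k × Fin k := fun m => (p.1 ⟨d₀ - 1 - m, by omega⟩, p.2 ⟨d₀ - 1 - m, by omega⟩)
  have hs : ∀ t : Fin d₀, s (d₀ - 1 - t) = (p.1 t, p.2 t) := by
    intro t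
    have e1 : (⟨d₀ - 1 - (d₀ - 1 - t), by omega⟩ : Fin d₀) = t := by
      ext; simp; omega
    simp only [s, e1]
  refine ⟨s, Finsupp.mapDomain (skipMap k (seqMin p.1) (seqMin p.2)) y, fun m => hpS _, ?_, ?_⟩
  · rw [Finsupp.degree_mapDomain, hy.1]
  · have e0 : (⟨0, by omega⟩ : Fin d₀) = ⟨d₀ - 1 - (d₀ - 1), by omega⟩ := by simp
    rw [pairExp_add, pairExp_congr (s := fun m => s (d₀ + m))
      (s' := fun _ => (p.1 ⟨0, by omega⟩, p.2 ⟨0, by omega⟩)), pairExp_const,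
      ← seqExp_eq_pairExp p s hs, skip₂_eq, seqMin_eq_of_monotone hm1 (by omega),
      seqMin_eq_of_monotone hm2 (by omega)]
    · rw [mon, mon, mon, rename_monomial]
      change mon _ * mon _ ^ _ * mon _ ^ _ = _
      congr 1
      rw [mon_pow, mon_mul, smul_smul, Nat.mul_sub, mul_one, ← pow_add]
    · intro m _
      have : (⟨d₀ - 1 - (d₀ + m), by omega⟩ : Fin d₀) = ⟨0, by omega⟩ := by
        ext; simp; omega
      simp only [s, this]

theorem genSet_isHomogeneous (hn : DegSeq c D n) (hk : k = c + 2) (hd₀ : 2 < d₀) (hD : d₀ ≤ D)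
    (hB : B ⊆ PInc k d₀) {g : P k} (hg : g ∈ genSet k d₀ D (n D) B) : g.IsHomogeneous (n 0) := by
  obtain ⟨s, y, hs, hy, rfl⟩ := exists_of_mem_genSet hd₀ hD hB hg
  rw [hn.zero_eq D le_rfl, ← degree_pairExp hk s hs D, ← hy, mon_pow, mon_mul]
  convert mon_isHomogeneous (k := k) _ using 1
  rw [map_add, map_nsmul, smul_eq_mul]

/-- A variable omitted from the lowest bit has even exponent. -/
theorem phi_genSet (hd₀ : 2 < d₀) (hD : d₀ ≤ D) (hB : B ⊆ PInc k d₀) {m : ℕ}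
    {g : P k} (hg : g ∈ genSet k d₀ D m B) : phi k g = 0 := by
  obtain ⟨s, y, hs, hy, rfl⟩ := exists_of_mem_genSet hd₀ hD hB hg
  obtain ⟨D, rfl⟩ : ∃ E, D = E + 1 := ⟨D - 1, by omega⟩
  rw [pairExp_succ', ← mon_mul, ← mon_pow, mon_exceptExp, pow_succ 2 D, pow_mul, mul_assoc,
    ← mul_pow, phi_mul_sq, sqf, phi_prod, if_neg, zero_mul]
  intro h
  have := Finset.mem_univ (s 0).1
  rw [← h] at this
  simp at this

/-- Steenrod squares are homogeneous, so restricting a functional to one degree preserves vanishing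
on hit polynomials. -/
theorem IsK.of_homogeneousComponent {N : ℕ} (hZ : ∀ i u, 0 < i → Z (Sq k i u) = 0) :
    IsK (Z.comp (homogeneousComponent N)) N := by
  refine ⟨fun i u hi => ?_, fun a ha => ?_⟩
  · have : (Z.comp (homogeneousComponent N)).comp (Sq k i) = 0 := by
      refine lin_ext fun a => ?_
      simp only [LinearMap.comp_apply, LinearMap.zero_apply]
      rw [homogeneousComponent_of_mem (Sq_mon_isHomogeneous i a)]
      split_ifs
      · exact hZ i _ hi
      · simp
    exact LinearMap.congr_fun this u
  · rw [LinearMap.comp_apply, homogeneousComponent_of_mem (mon_isHomogeneous a), if_neg (Ne.symm ha),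
      map_zero]

theorem span_genSet (hn : DegSeq c D n) (hk : k = c + 2) (hd₀ : 2 < d₀) (hD : d₀ ≤ D)
    (hB : B ⊆ PInc k d₀) (hcomp : Compatible k d₀ B) :
    Submodule.span (ZMod 2) ((hit k).mkQ '' genSet k d₀ D (n D) B) = kamekoKer k (n 0) := by
  apply le_antisymm
  · rw [Submodule.span_le]
    rintro _ ⟨g, hg, rfl⟩
    refine ⟨⟨g, genSet_isHomogeneous hn hk hd₀ hD hB hg, rfl⟩, ?_⟩
    rw [SetLike.mem_coe, LinearMap.mem_ker, kameko, Submodule.mkQ_apply, Submodule.mapQ_apply,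
      phi_genSet hd₀ hD hB hg]
    rfl
  · rintro _ ⟨⟨f, hf, rfl⟩, hker⟩
    by_contra hcon
    -- A class outside the span is detected by a functional on `QP k` that kills the span; its
    -- pullback to `P k` kills hit polynomials.
    obtain ⟨g, hgf, hg⟩ := Submodule.exists_le_ker_of_notMem hcon
    set Z' : Fn k := g.comp (hit k).mkQ with hZ'
    have hsq : ∀ i u, 0 < i → Z' (Sq k i u) = 0 := by
      intro i u hi
      have hmem : Sq k i u ∈ hit k :=
        Submodule.mem_iSup_of_mem (⟨i, hi⟩ : {n : ℕ // 0 < n}) ⟨u, rfl⟩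
      rw [hZ', LinearMap.comp_apply, Submodule.mkQ_apply,
        (Submodule.Quotient.mk_eq_zero _).2 hmem, map_zero]
    have hhom : ∀ f : P k, f.IsHomogeneous (n 0) → homogeneousComponent (n 0) f = f := by
      intro f hf
      rw [homogeneousComponent_of_mem hf, if_pos rfl]
    have hK := IsK.of_homogeneousComponent (N := n 0) hsq
    have hgen : ∀ x ∈ genSet k d₀ D (n D) B, (Z'.comp (homogeneousComponent (n 0))) x = 0 := by
      intro x hx
      rw [LinearMap.comp_apply, hhom x (genSet_isHomogeneous hn hk hd₀ hD hB hx)]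
      exact hg (Submodule.subset_span ⟨x, hx, rfl⟩)
    have hval := Fn.val_eq_zero hn hk hd₀ hD hB hcomp hK hgen
    have hphi : phi k f ∈ hit k := by
      rw [SetLike.mem_coe, LinearMap.mem_ker, kameko, Submodule.mkQ_apply, Submodule.mapQ_apply]
        at hker
      exact (Submodule.Quotient.mk_eq_zero _).1 hker
    have h0 := hK.eq_zero_of_phi_mem_hit hn hk (by omega) hval hphi
    rw [LinearMap.comp_apply, hhom f hf] at h0
    exact hgf h0

end

/-! ### Dimensions -/

theorem module_finite_QPdeg (k m : ℕ) : Module.Finite (ZMod 2) (QPdeg k m) :=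
  Module.Finite.iff_fg.2 ((homogeneousSubmodule_fg (Fin k) (ZMod 2) m).map _)

theorem finite_admissibleMonomials (k m : ℕ) : (admissibleMonomials k m).Finite :=
  (finite_degree_eq k m).subset fun _ ha => ha.1

/-- Admissible monomials are independent modulo hit polynomials: the greatest one in a relation
would be inadmissible. -/
theorem ncard_admissibleMonomials_le (k m : ℕ) :
    (admissibleMonomials k m).ncard ≤ Module.finrank (ZMod 2) (QPdeg k m) := by
  have := module_finite_QPdeg k m
  have := (finite_admissibleMonomials k m).fintype
  let v : admissibleMonomials k m → QPdeg k m := fun a =>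
    ⟨(hit k).mkQ (mon a.1), mon a.1, by
      have := mon_isHomogeneous a.1
      rw [a.2.1] at this
      exact this, rfl⟩
  have hv : LinearIndependent (ZMod 2) v := by
    rw [linearIndependent_iff']
    intro S r hr
    by_contra! hcon
    obtain ⟨x, hx, hrx⟩ := hcon
    obtain ⟨a, ha, hmax⟩ := Finset.exists_max_image (S.filter fun a => r a ≠ 0)
      (fun a => monKey a.1) ⟨x, Finset.mem_filter.2 ⟨hx, hrx⟩⟩
    have hone : ∀ z : ZMod 2, z ≠ 0 → z = 1 := by decide
    have h1 : ∑ b ∈ S.filter fun a => r a ≠ 0, v b = 0 := by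
      rw [← hr, Finset.sum_filter]
      refine Finset.sum_congr rfl fun b _ => ?_
      split_ifs with hb
      · rw [hone _ hb, one_smul]
      · rw [not_not.1 hb, zero_smul]
    rw [← Finset.add_sum_erase _ _ ha] at h1
    have h2 : (hit k).mkQ (mon a.1 + ∑ b ∈ ((S.filter fun a => r a ≠ 0).erase a).image
        Subtype.val, mon b) = 0 := by
      rw [Finset.sum_image Subtype.val_injective.injOn, map_add, map_sum]
      have := congrArg Subtype.val h1
      simpa [v] using this
    refine a.2.2 ⟨_, fun b' hb' => ?_, (Submodule.Quotient.mk_eq_zero _).1 h2⟩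
    obtain ⟨b, hb, rfl⟩ := Finset.mem_image.1 hb'
    rw [Finset.mem_erase] at hb
    refine ⟨b.2.1.trans a.2.1.symm, monKey_lt_iff.1 (lt_of_le_of_ne (hmax b hb.2) fun h => ?_)⟩
    exact hb.1 (Subtype.ext (monKey_injective h))
  have := hv.fintype_card_le_finrank
  rwa [← Nat.card_eq_fintype_card, Nat.card_coe_set_eq] at this

theorem finrank_span_genSet_le (k d₀ d m : ℕ) (B : Set (SeqPair k d₀)) :
    Module.finrank (ZMod 2) (Submodule.span (ZMod 2) ((hit k).mkQ '' genSet k d₀ d m B)) ≤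
      B.ncard * Module.finrank (ZMod 2) (QPdeg (k - 2) m) := by
  let F : SeqPair k d₀ × (Fin (k - 2) →₀ ℕ) → QP k := fun x => (hit k).mkQ
    (mon (seqExp x.1) * mon (exceptExp k (seqMin x.1.1) (seqMin x.1.2)) ^ (2 ^ d - 2 ^ d₀) *
      skip₂ k (seqMin x.1.1) (seqMin x.1.2) (mon x.2) ^ 2 ^ d)
  have hset : (hit k).mkQ '' genSet k d₀ d m B = F '' (B ×ˢ admissibleMonomials (k - 2) m) := by
    ext q
    constructor
    · rintro ⟨_, ⟨p, hp, y, hy, rfl⟩, rfl⟩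
      exact ⟨(p, y), ⟨hp, hy⟩, rfl⟩
    · rintro ⟨⟨p, y⟩, ⟨hp, hy⟩, rfl⟩
      exact ⟨_, ⟨p, hp, y, hy, rfl⟩, rfl⟩
  have hfin : (B ×ˢ admissibleMonomials (k - 2) m).Finite :=
    (Set.toFinite B).prod (finite_admissibleMonomials _ _)
  rw [hset]
  have := (hfin.image F).fintype
  refine (finrank_span_le_card _).trans ?_
  rw [← Set.ncard_eq_toFinset_card']
  refine (Set.ncard_image_le hfin).trans ?_
  rw [Set.ncard_prod]
  exact Nat.mul_le_mul_left _ (ncard_admissibleMonomials_le _ _)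

/-! ### The degrees -/

/-- Adding c gives ∑ 2^(d_i - t), in which only the two least terms may coincide, so `le_of_powSum`
applies with b = `d c - t`. -/
theorem degSeq_of_exponents {c : ℕ} (hc : 2 ≤ c) {d : ℕ → ℕ}
    (hd_strict : ∀ i, 1 ≤ i → i + 1 ≤ c - 1 → d (i + 1) < d i) (hd_last : d c ≤ d (c - 1)) :
    DegSeq c (d c) fun t => ∑ i ∈ Finset.Icc 1 c, (2 ^ (d i - t) - 1) := by
  have hge : ∀ e i, i + e + 1 = c → 1 ≤ i → d c ≤ d i := by
    intro e
    induction e with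
    | zero =>
      intro i hi _
      rwa [show i = c - 1 by omega]
    | succ e ih =>
      intro i hi h1
      exact (ih (i + 1) (by omega) (by omega)).trans (hd_strict i h1 (by omega)).le
  have hge' : ∀ i ∈ Finset.Icc 1 c, d c ≤ d i := by
    intro i hi
    rw [Finset.mem_Icc] at hi
    rcases hi.2.lt_or_eq with h | rfl
    · exact hge (c - 1 - i) i (by omega) hi.1
    · rfl
  refine ⟨fun t ht => ?_, fun t e N s ht hs hp hN => ?_⟩
  · have h1 : c = ∑ i ∈ Finset.Icc 1 c, 1 := by simp
    conv_rhs => rhs; rw [h1]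
    rw [Finset.mul_sum, ← Finset.sum_add_distrib]
    refine Finset.sum_congr rfl fun i hi => ?_
    have h2 := hge' i hi
    have h3 := Nat.one_le_two_pow (n := d i - (t + 1))
    rw [show d i - t = d i - (t + 1) + 1 by omega, pow_succ]
    omega
  · have hsum : N + s = 2 ^ (d c - t) +
        ∑ r ∈ Finset.range (c - 1), 2 ^ (d (c - 1 - r) - t) := by
      rw [hN]
      have h1 : c = ∑ i ∈ Finset.Icc 1 c, 1 := by simp
      conv_lhs => rw [add_comm]; lhs; rw [h1]
      rw [← Finset.sum_add_distrib]
      have h2 : ∀ i ∈ Finset.Icc 1 c, 1 + (2 ^ (d i - t) - 1) = 2 ^ (d i - t) := by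
        intro i _
        have := Nat.one_le_two_pow (n := d i - t)
        omega
      rw [Finset.sum_congr rfl h2]
      obtain ⟨b, rfl⟩ : ∃ b, c = b + 1 := ⟨c - 1, by omega⟩
      rw [Finset.sum_Icc_succ_top (by omega), add_comm, Nat.add_sub_cancel,
        ← Finset.sum_range_reflect]
      congr 1
      rw [← Finset.Ico_succ_right_eq_Icc, Nat.succ_eq_succ, Nat.succ_eq_add_one,
        Finset.sum_Ico_eq_sum_range,
        Nat.add_sub_cancel]
      refine Finset.sum_congr rfl fun r hr => ?_
      rw [Finset.mem_range] at hr
      rw [show b - (b - 1 - r) = 1 + r by omega]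
    have := le_of_powSum (b := d c - t) (N := c - 1) (g := fun r => d (c - 1 - r) - t)
      (fun _ => by simp; omega) (fun i hi => ?_) hs hp hsum
    · omega
    · have h1 := hd_strict (c - 1 - (i + 1)) (by omega) (by omega)
      have h2 := hge' (c - 1 - i) (by rw [Finset.mem_Icc]; omega)
      rw [show c - 1 - (i + 1) + 1 = c - 1 - i by omega] at h1
      omega

theorem DegSeq.beta_iterate {c D : ℕ} {n : ℕ → ℕ} (hn : DegSeq c D n) (t : ℕ) (ht : t ≤ D) :
    (beta (c + 2))^[t] (n 0 : ℤ) = n t := by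
  induction t with
  | zero => rfl
  | succ t ih =>
    rw [Function.iterate_succ_apply', ih (by omega), hn.step t ht, beta]
    have : ((2 * n (t + 1) + c : ℕ) : ℤ) - ((c + 2 : ℕ) : ℤ) + 2 = 2 * (n (t + 1) : ℤ) := by
      push_cast; ring
    rw [this, if_pos (even_two_mul _)]
    omega

end HitProblem

theorem mainTheorem3 (k d₀ : ℕ) (hk : 4 ≤ k) (hd₀ : 2 < d₀)
    (d : ℕ → ℕ)
    (hd_strict : ∀ i, 1 ≤ i → i + 1 ≤ k - 3 → d (i + 1) < d i)
    (hd_last : d (k - 2) ≤ d (k - 3))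
    (hd_ge : d₀ ≤ d (k - 2))
    (n m : ℕ)
    (hn : n = ∑ i ∈ Finset.Icc 1 (k - 2), (2 ^ d i - 1))
    (hm : m = ∑ i ∈ Finset.Icc 1 (k - 3), (2 ^ (d i - d (k - 2)) - 1))
    (B : Set (HitProblem.SeqPair k d₀))
    (hB : B ⊆ HitProblem.PInc k d₀)
    (hcomp : HitProblem.Compatible k d₀ B) :
    (m : ℤ) = (HitProblem.beta k)^[d (k - 2)] (n : ℤ) ∧
    Submodule.span (ZMod 2)
        ((HitProblem.hit k).mkQ '' HitProblem.genSet k d₀ (d (k - 2)) m B) =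
      HitProblem.kamekoKer k n ∧
    Module.finrank (ZMod 2) (HitProblem.kamekoKer k n) ≤
      B.ncard * Module.finrank (ZMod 2) (HitProblem.QPdeg (k - 2) m) := by
  obtain ⟨c, hc⟩ : ∃ c, k = c + 2 := ⟨k - 2, by omega⟩
  have hc2 : k - 2 = c := by omega
  have hc3 : k - 3 = c - 1 := by omega
  rw [hc2] at hd_last hd_ge hn hm
  rw [hc3] at hd_strict hd_last hm
  have hseq := HitProblem.degSeq_of_exponents (by omega) hd_strict hd_last
  set N : ℕ → ℕ := fun t => ∑ i ∈ Finset.Icc 1 c, (2 ^ (d i - t) - 1) with hN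
  have hn0 : n = N 0 := by simpa [hN] using hn
  -- The summand i = c of `N (d c)` is 2⁰ - 1 = 0.
  have hmD : m = N (d c) := by
    obtain ⟨b, rfl⟩ : ∃ b, c = b + 1 := ⟨c - 1, by omega⟩
    rw [hm, hN]
    simp only
    rw [Finset.sum_Icc_succ_top (by omega)]
    simp
  have hspan := HitProblem.span_genSet hseq hc hd₀ hd_ge hB hcomp
  rw [hc2, hn0]
  rw [← hmD] at hspan
  refine ⟨?_, hspan, ?_⟩
  · rw [hc, hseq.beta_iterate (d c) le_rfl, hmD]
  · rw [← hspan, ← hc2]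
    exact HitProblem.finrank_span_genSet_le k d₀ _ m B
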